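/- Let $T$ be a finite nonabelian simple group, let $\ell$ be a positive integer, and let $G = T^\ell$. Let $H$ be a finite group and let $\gamma\colon H \to G$ be a minimal extension, that is, a surjective homomorphism such that $\gamma(K) < G$ for every proper subgroup $K < H$. Let $k$ be an algebraically closed field and let $\lambda\colon H \to \mathrm{PGL}_m(k)$ be a faithful (i.e. injective) primitive projective representation. Here $\lambda$ is primitive if the preimage $\widetilde H$ of $\lambda(H)$ in $\mathrm{GL}_m(k)$ acts irreducibly on $V = k^m$ and there is no decomposition $V = V_1 \oplus \cdots \oplus V_r$ into $r > 1$ nonzero subspaces that are permuted among themselves by $\widetilde H$. Let $n'_T$ be the least $n$ such that $T$ is isomorphic to an irreducible subgroup of $\mathrm{GL}_{2n}(2)$. If $\mathrm{char}\, k \neq 2$, assume that $m < \ell \cdot 2^{n'_T}$. Then $\gamma$ is an isomorphism. -/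

import Mathlib

/-- A homomorphism `γ : H → G` is a minimal extension of `G` if it is surjective and every proper
subgroup of `H` has a proper image in `G`. -/
structure IsMinimalExtension {H G : Type*} [Group H] [Group G] (γ : H →* G) : Prop where
  surjective : Function.Surjective γ
  map_lt_top : ∀ K : Subgroup H, K < ⊤ → K.map γ < ⊤

/-- The natural representation of a subgroup of `GL_m(k)` on `k ^ m`. -/
def natRep {k : Type*} [Field k] {m : ℕ}
    (S : Subgroup (Matrix.GeneralLinearGroup (Fin m) k)) : Representation k S (Fin m → k) :=
  (Units.coeHom ((Fin m → k) →ₗ[k] (Fin m → k))).comp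
    ((Matrix.GeneralLinearGroup.toLin (n := Fin m) (R := k)).toMonoidHom.comp S.subtype)

/-- A subgroup of `GL_m(k)` is imprimitive if it permutes among themselves the (nonzero) summands
of a decomposition of `k ^ m` as a direct sum of more than one subspace. -/
def IsImprimitiveSubgroup {k : Type*} [Field k] {m : ℕ}
    (S : Subgroup (Matrix.GeneralLinearGroup (Fin m) k)) : Prop :=
  ∃ (r : ℕ) (V : Fin r → Submodule k (Fin m → k)), 1 < r ∧ (∀ i, V i ≠ ⊥) ∧
    DirectSum.IsInternal V ∧
    ∀ g : S, ∃ σ : Equiv.Perm (Fin r), ∀ i, (V i).map (natRep S g) = V (σ i)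

/-- The full preimage in `GL_m(k)` of the image of a projective representation
`lam : H → PGL_m(k)`. -/
def linearPreimage {H k : Type*} [Group H] [Field k] {m : ℕ}
    (lam : H →* Matrix.ProjGenLinGroup (Fin m) k) :
    Subgroup (Matrix.GeneralLinearGroup (Fin m) k) :=
  lam.range.comap Matrix.ProjGenLinGroup.mk

/-- A projective representation `lam : H → PGL_m(k)` is primitive if the preimage of its image in
`GL_m(k)` is irreducible and not imprimitive. -/
structure IsPrimitiveProjRep {H k : Type*} [Group H] [Field k] {m : ℕ}
    (lam : H →* Matrix.ProjGenLinGroup (Fin m) k) : Prop where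
  irreducible : (natRep (linearPreimage lam)).IsIrreducible
  not_imprimitive : ¬ IsImprimitiveSubgroup (linearPreimage lam)

/-- `G` is isomorphic to an irreducible subgroup of `GL_d(2)`. -/
def EmbedsIrreduciblyGL2 (G : Type*) [Group G] (d : ℕ) : Prop :=
  ∃ f : G →* Matrix.GeneralLinearGroup (Fin d) (ZMod 2),
    Function.Injective f ∧ (natRep f.range).IsIrreducible

/-- The least `n` such that `G` is isomorphic to an irreducible subgroup of `GL_{2n}(2)`. -/
noncomputable def nPrime (G : Type*) [Group G] : ℕ :=
  sInf {n : ℕ | EmbedsIrreduciblyGL2 G (2 * n)}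

/-!
Suppose that `γ` is not injective. Its kernel `M` lies in the Frattini subgroup of `H` and is
nilpotent. For commuting `x` and `y` in `H`, lifts of `lam x` and `lam y` commute up to a scalar,
the pairing of `x` and `y`. By Clifford theory, primitivity makes the pairing nondegenerate on every
abelian normal subgroup (`TwistedRep.Primitive.nondeg`).

The elements of odd order in the center of `M` form an abelian normal subgroup `O`. The pairing has
a square root on it, so Baer's trick and a Frattini argument give a complement of `O` in `H`
(`TwistedRep.Nondeg.exists_complement`). As `M` is contained in the Frattini subgroup, `O` is
trivial. Duality for the pairing then shows that `M` consists of central involutions of `M`, and that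
the centralizer of `M` is `M * D`, where `D` is the group of elements whose lifts commute with the
lifts of `M`, and `D` meets `M` trivially (`TwistedRep.Primitive.ker_structure`). In particular
`char k ≠ 2`, since the pairing on `M` has values `±1`.

So `M` is a symplectic space over the field of two elements on which `T ^ l` acts, with all
submodules nondegenerate. Let `j` be the number of factors that act nontrivially. For such a factor
`T i`, a minimal nontrivial `T i`-submodule is faithful and, by Fong's lemma, of even dimension, so
its dimension is at least `2 * nPrime T`; and each further factor that acts nontrivially on an
irreducible module at least doubles the dimension, as a nonabelian simple group cannot act through a
finite field of endomorphisms. Hence `dim M ≥ 2 * nPrime T * j` (`mul_ncard_activeFactors_le`).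

The other `l - j` factors lift to commuting normal subgroups of `D`, and peeling off eigenspaces
factor by factor shows that every nonzero `D`-stable subspace of `k ^ m` has dimension at least
`l - j + 1` (`TwistedRep.Irreducible.card_add_one_le_finrank`). The weight spaces of a maximal
isotropic subgroup of `M` are `D`-stable and there are at least `√|M|` of them
(`TwistedRep.Nondeg.sq_mul_card_le`). Therefore `m ≥ (l - j + 1) * 2 ^ (nPrime T * j)`, which is at
least `l * 2 ^ nPrime T` because `j` and `nPrime T` are positive.
-/

/-! ### Operators representing a group up to scalars -/

/-- A projective representation of `H` on `V`, given by a choice of operators `op h` and by the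
scalar factors `cocycle` that measure the failure of `op` to be multiplicative. -/
structure TwistedRep (k H V : Type*) [Field k] [Group H] [AddCommGroup V] [Module k V] where
  op : H → Module.End k V
  cocycle : H → H → kˣ
  op_one : op 1 = 1
  op_mul : ∀ x y, op x * op y = (cocycle x y : k) • op (x * y)

namespace TwistedRep

variable {k H V : Type*} [Field k] [Group H] [AddCommGroup V] [Module k V]

/-- The projective representation is faithful: only the identity acts as a scalar. -/
def Faithful (R : TwistedRep k H V) : Prop := ∀ (x : H) (c : k), R.op x = c • 1 → x = 1

/-- The submodule `W` is stable under the operators of all elements of `S`. -/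
def Stable (R : TwistedRep k H V) (S : Set H) (W : Submodule k V) : Prop :=
  ∀ h ∈ S, ∀ w ∈ W, R.op h w ∈ W

/-- `V ≠ 0` has no stable submodules except the two obvious ones. -/
def Irreducible (R : TwistedRep k H V) : Prop :=
  Nontrivial V ∧ ∀ W : Submodule k V, R.Stable Set.univ W → W = ⊥ ∨ W = ⊤

/-- No decomposition of `V` into more than one nonzero summand is permuted by the operators. -/
def Primitive (R : TwistedRep k H V) : Prop :=
  ∀ (r : ℕ) (U : Fin r → Submodule k V), (∀ i, U i ≠ ⊥) → DirectSum.IsInternal U →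
    (∀ h, ∃ σ : Equiv.Perm (Fin r), ∀ i, (U i).map (R.op h) = U (σ i)) → r ≤ 1

/-- The scalar by which the operators of two commuting elements commute. -/
def pairing (R : TwistedRep k H V) (x y : H) : kˣ := R.cocycle x y * (R.cocycle y x)⁻¹

variable (R : TwistedRep k H V)

lemma op_inv_mul (x : H) : R.op x⁻¹ * R.op x = (R.cocycle x⁻¹ x : k) • 1 := by
  rw [R.op_mul, inv_mul_cancel, R.op_one]

lemma op_mul_inv (x : H) : R.op x * R.op x⁻¹ = (R.cocycle x x⁻¹ : k) • 1 := by
  rw [R.op_mul, mul_inv_cancel, R.op_one]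

lemma isUnit_op (x : H) : IsUnit (R.op x) := by
  refine isUnit_iff_exists_and_exists.2 ⟨⟨(R.cocycle x x⁻¹ : k)⁻¹ • R.op x⁻¹, ?_⟩,
    ⟨(R.cocycle x⁻¹ x : k)⁻¹ • R.op x⁻¹, ?_⟩⟩
  · rw [mul_smul_comm, op_mul_inv, smul_smul, inv_mul_cancel₀ (Units.ne_zero _), one_smul]
  · rw [smul_mul_assoc, op_inv_mul, smul_smul, inv_mul_cancel₀ (Units.ne_zero _), one_smul]

lemma op_injective (x : H) : Function.Injective (R.op x) :=
  ((Module.End.isUnit_iff _).1 (R.isUnit_op x)).1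

lemma smul_isUnit_cancel [Nontrivial V] {A : Module.End k V} (hA : IsUnit A) {a b : k}
    (h : a • A = b • A) : a = b :=
  smul_left_injective k hA.ne_zero h

lemma op_mul_of_commute {x y : H} (h : Commute x y) :
    R.op x * R.op y = (R.pairing x y : k) • (R.op y * R.op x) := by
  rw [R.op_mul, R.op_mul, h.eq, smul_smul, pairing, ← Units.val_mul, inv_mul_cancel_right]

lemma eq_pairing [Nontrivial V] {x y : H} (h : Commute x y) {a : k}
    (ha : R.op x * R.op y = a • (R.op y * R.op x)) : a = R.pairing x y := by
  rw [R.op_mul_of_commute h] at ha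
  exact (smul_isUnit_cancel ((R.isUnit_op y).mul (R.isUnit_op x)) ha).symm

lemma pairing_eq_one_iff [Nontrivial V] {x y : H} (h : Commute x y) :
    R.pairing x y = 1 ↔ R.op x * R.op y = R.op y * R.op x := by
  constructor
  · intro h1
    rw [R.op_mul_of_commute h, h1, Units.val_one, one_smul]
  · intro h1
    have := R.eq_pairing h (a := 1) (by rw [h1, one_smul])
    exact Units.ext this.symm

lemma pairing_self (x : H) : R.pairing x x = 1 := by simp [pairing]

lemma pairing_swap (x y : H) : R.pairing y x = (R.pairing x y)⁻¹ := by simp [pairing]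

lemma pairing_mul_right [Nontrivial V] {x y z : H} (hy : Commute x y) (hz : Commute x z) :
    R.pairing x (y * z) = R.pairing x y * R.pairing x z := by
  symm
  apply Units.ext
  apply R.eq_pairing (hy.mul_right hz)
  have hc : (R.cocycle y z : k) ≠ 0 := Units.ne_zero _
  apply smul_right_injective _ hc
  dsimp only
  rw [← mul_smul_comm, ← R.op_mul y z, smul_comm, ← smul_mul_assoc, ← R.op_mul y z, ← mul_assoc,
    R.op_mul_of_commute hy, smul_mul_assoc, mul_assoc, R.op_mul_of_commute hz, mul_smul_comm,
    smul_smul, Units.val_mul, mul_assoc]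

lemma pairing_mul_left [Nontrivial V] {x y z : H} (hx : Commute x z) (hy : Commute y z) :
    R.pairing (x * y) z = R.pairing x z * R.pairing y z := by
  rw [R.pairing_swap z, R.pairing_mul_right hx.symm hy.symm, R.pairing_swap x z,
    R.pairing_swap y z, mul_inv, inv_inv, inv_inv]

/-- Operators of conjugate elements are conjugate up to scalars. -/
lemma exists_op_mul_eq_conj (h x : H) :
    ∃ a : kˣ, R.op h * R.op x = (a : k) • (R.op (h * x * h⁻¹) * R.op h) := by
  refine ⟨R.cocycle h x * (R.cocycle (h * x * h⁻¹) h)⁻¹, ?_⟩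
  rw [R.op_mul, R.op_mul, smul_smul, ← Units.val_mul, inv_mul_cancel_right, inv_mul_cancel_right]

lemma pairing_conj [Nontrivial V] {x y : H} (hxy : Commute x y) (h : H) :
    R.pairing (h * x * h⁻¹) (h * y * h⁻¹) = R.pairing x y := by
  symm
  apply Units.ext
  apply R.eq_pairing
  · simpa using hxy.map (MulAut.conj h).toMonoidHom
  obtain ⟨a, ha⟩ := R.exists_op_mul_eq_conj h x
  obtain ⟨b, hb⟩ := R.exists_op_mul_eq_conj h y
  apply (R.isUnit_op h).mul_left_injective
  apply smul_right_injective _ (mul_ne_zero a.ne_zero b.ne_zero)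
  dsimp only
  have h1 : R.op h * (R.op x * R.op y) =
      ((a : k) * b) • (R.op (h * x * h⁻¹) * R.op (h * y * h⁻¹) * R.op h) := by
    rw [← mul_assoc, ha, smul_mul_assoc, mul_assoc, hb, mul_smul_comm, smul_smul, mul_assoc (R.op _)]
  have h2 : R.op h * (R.op y * R.op x) =
      ((a : k) * b) • (R.op (h * y * h⁻¹) * R.op (h * x * h⁻¹) * R.op h) := by
    rw [← mul_assoc, hb, smul_mul_assoc, mul_assoc, ha, mul_smul_comm, smul_smul, mul_assoc (R.op _),
      mul_comm (b : k)]
  rw [← h1, smul_mul_assoc, smul_comm, ← h2, R.op_mul_of_commute hxy, mul_smul_comm]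

lemma cocycle_mul_cocycle [Nontrivial V] (x y z : H) :
    R.cocycle x y * R.cocycle (x * y) z = R.cocycle y z * R.cocycle x (y * z) := by
  apply Units.ext
  apply smul_isUnit_cancel (R.isUnit_op (x * y * z))
  rw [Units.val_mul, Units.val_mul, mul_smul, ← R.op_mul, ← smul_mul_assoc, ← R.op_mul, mul_smul,
    mul_assoc x, ← R.op_mul x, ← mul_smul_comm, ← R.op_mul, mul_assoc]

/-- The commutator pairing of two elementwise commuting subgroups, as a bimultiplicative map. -/
def pairingHom [Nontrivial V] (A B : Subgroup H) (h : ∀ a ∈ A, ∀ b ∈ B, Commute a b) :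
    A →* (B →* kˣ) :=
  MonoidHom.mk' (fun a => MonoidHom.mk' (fun b => R.pairing a b) fun b c => by
      simpa using R.pairing_mul_right (h a a.2 b b.2) (h a a.2 c c.2)) fun a a' => by
    ext b
    simpa using congrArg Units.val (R.pairing_mul_left (h a a.2 b b.2) (h a' a'.2 b b.2))

@[simp] lemma pairingHom_apply [Nontrivial V] (A B : Subgroup H)
    (h : ∀ a ∈ A, ∀ b ∈ B, Commute a b) (a : A) (b : B) :
    R.pairingHom A B h a b = R.pairing a b := rfl

lemma pairing_one_left [Nontrivial V] (y : H) : R.pairing 1 y = 1 := by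
  have := R.pairing_mul_left (Commute.one_left y) (Commute.one_left y)
  rw [mul_one] at this
  exact left_eq_mul.1 this

lemma pairing_inv_left [Nontrivial V] {x y : H} (h : Commute x y) :
    R.pairing x⁻¹ y = (R.pairing x y)⁻¹ := by
  have := R.pairing_mul_left h.inv_left h
  rw [inv_mul_cancel, pairing_one_left] at this
  exact eq_inv_of_mul_eq_one_left this.symm

/-- The elements of `A` that pair trivially with `S`. -/
def perp [Nontrivial V] (A : Subgroup H) (S : Set H) (hcomm : ∀ a ∈ A, ∀ s ∈ S, Commute a s) :
    Subgroup H where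
  carrier := {x | x ∈ A ∧ ∀ y ∈ S, R.pairing x y = 1}
  one_mem' := ⟨one_mem A, fun y _ => R.pairing_one_left y⟩
  mul_mem' := fun {x x'} hx hx' => ⟨mul_mem hx.1 hx'.1, fun y hy => by
    rw [R.pairing_mul_left (hcomm x hx.1 y hy) (hcomm x' hx'.1 y hy), hx.2 y hy, hx'.2 y hy,
      one_mul]⟩
  inv_mem' := fun {x} hx => ⟨inv_mem hx.1, fun y hy => by
    rw [R.pairing_inv_left (hcomm x hx.1 y hy), hx.2 y hy, inv_one]⟩

/-- The commutator pairing has trivial radical on `A`. -/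
def Nondeg (A : Subgroup H) : Prop := ∀ x ∈ A, (∀ y ∈ A, R.pairing x y = 1) → x = 1

end TwistedRep

/-- A finite group has at most as many linear characters as elements. -/
lemma card_monoidHom_units_le (A k : Type*) [Group A] [Finite A] [Field k] :
    Finite (A →* kˣ) ∧ Nat.card (A →* kˣ) ≤ Nat.card A := by
  classical
  have := Fintype.ofFinite A
  have hinj : Function.Injective fun f : A →* kˣ => (Units.coeHom k).comp f := by
    intro f g hfg
    ext a
    exact DFunLike.congr_fun hfg a
  have hli := (linearIndependent_monoidHom A k).comp _ hinj
  have hfin : Finite (A →* kˣ) := hli.finite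
  have := Fintype.ofFinite (A →* kˣ)
  refine ⟨hfin, ?_⟩
  have := hli.fintype_card_le_finrank
  simpa [Nat.card_eq_fintype_card] using this

namespace TwistedRep

variable {k H V : Type*} [Field k] [Group H] [AddCommGroup V] [Module k V]
variable (R : TwistedRep k H V)

/-- A nondegenerate pairing on a finite abelian group induces all its linear characters. -/
lemma Nondeg.exists_pairing_eq [Nontrivial V] [Finite H] {A : Subgroup H} (hA : R.Nondeg A)
    (hcomm : ∀ a ∈ A, ∀ b ∈ A, Commute a b) (χ : A →* kˣ) :
    ∃ y ∈ A, ∀ x : A, χ x = R.pairing y x := by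
  obtain ⟨hfin, hcard⟩ := card_monoidHom_units_le A k
  have hinj : Function.Injective (R.pairingHom A A hcomm) := by
    rw [injective_iff_map_eq_one]
    intro a ha
    exact Subtype.ext (hA a a.2 fun y hy => DFunLike.congr_fun ha ⟨y, hy⟩)
  have hbij := (Nat.bijective_iff_injective_and_card (R.pairingHom A A hcomm)).2
    ⟨hinj, le_antisymm (Nat.card_le_card_of_injective _ hinj) hcard⟩
  obtain ⟨y, hy⟩ := hbij.2 χ
  exact ⟨y, y.2, fun x => by rw [← hy]; rfl⟩

end TwistedRep

/-! ### Symmetric cocycles and Baer's trick -/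

/-- The underlying set of the extension of `A` by `M` that belongs to a 2-cocycle `σ`. -/
structure CocycleExtension {A M : Type*} (σ : A → A → M) where
  fst : A
  snd : M

namespace CocycleExtension

variable {A M : Type*} [Group A] [CommGroup M] {σ : A → A → M}

/-- The group structure defined by a cocycle; it is commutative when `A` is commutative and the
cocycle is symmetric. -/
abbrev commGroup (hA : ∀ x y : A, x * y = y * x) (hsymm : ∀ x y, σ x y = σ y x)
    (hσ : ∀ x y z, σ x y * σ (x * y) z = σ y z * σ x (y * z)) :
    CommGroup (CocycleExtension σ) :=
  have h1 : ∀ x, σ 1 x = σ 1 1 := fun x => by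
    have := hσ 1 1 x
    simp only [one_mul, mul_one] at this
    exact (mul_right_cancel this).symm
  { mul := fun x y => ⟨x.fst * y.fst, x.snd * y.snd * σ x.fst y.fst⟩
    one := ⟨1, (σ 1 1)⁻¹⟩
    inv := fun x => ⟨x.fst⁻¹, (x.snd * σ x.fst⁻¹ x.fst * σ 1 1)⁻¹⟩
    mul_assoc := fun ⟨a, x⟩ ⟨b, y⟩ ⟨c, z⟩ => by
      refine congrArg₂ mk (mul_assoc a b c) ?_
      change x * y * σ a b * z * σ (a * b) c = x * (y * z * σ b c) * σ a (b * c)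
      calc _ = x * y * z * (σ a b * σ (a * b) c) := by
            simp only [mul_comm, mul_left_comm]
        _ = _ := by rw [hσ]; simp only [mul_assoc]
    one_mul := fun ⟨a, x⟩ => by
      refine congrArg₂ mk (one_mul a) ?_
      change (σ 1 1)⁻¹ * x * σ 1 a = x
      rw [h1 a, mul_right_comm, inv_mul_cancel, one_mul]
    mul_one := fun ⟨a, x⟩ => by
      refine congrArg₂ mk (mul_one a) ?_
      change x * (σ 1 1)⁻¹ * σ a 1 = x
      rw [hsymm a, h1 a, inv_mul_cancel_right]
    inv_mul_cancel := fun ⟨a, x⟩ => by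
      refine congrArg₂ mk (inv_mul_cancel a) ?_
      change (x * σ a⁻¹ a * σ 1 1)⁻¹ * x * σ a⁻¹ a = (σ 1 1)⁻¹
      rw [mul_assoc, mul_inv_rev, inv_mul_cancel_right]
    mul_comm := fun ⟨a, x⟩ ⟨b, y⟩ => by
      refine congrArg₂ mk (hA a b) ?_
      change x * y * σ a b = y * x * σ b a
      rw [hsymm, mul_comm x] }

end CocycleExtension

/-- A symmetric 2-cocycle of an abelian group with values in a divisible group is a coboundary,
because divisible groups are injective. -/
lemma exists_coboundary {A M : Type*} [Group A] [CommGroup M] [DivisibleBy (Additive M) ℤ]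
    (σ : A → A → M) (hA : ∀ x y : A, x * y = y * x) (hsymm : ∀ x y, σ x y = σ y x)
    (hσ : ∀ x y z, σ x y * σ (x * y) z = σ y z * σ x (y * z)) :
    ∃ μ : A → M, ∀ x y, σ x y * μ (x * y) = μ x * μ y := by
  let := CocycleExtension.commGroup hA hsymm hσ
  have h1 : ∀ x, σ x 1 = σ 1 1 := fun x => by
    have := hσ x 1 1
    simp only [mul_one] at this
    exact mul_right_cancel this
  let ι : M →* CocycleExtension σ := MonoidHom.mk' (fun m => ⟨1, m * (σ 1 1)⁻¹⟩) fun m n => by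
    refine congrArg₂ CocycleExtension.mk (one_mul 1).symm ?_
    change m * n * (σ 1 1)⁻¹ = m * (σ 1 1)⁻¹ * (n * (σ 1 1)⁻¹) * σ 1 1
    rw [mul_assoc (m * _), inv_mul_cancel_right, mul_right_comm]
  have hι : Function.Injective ι.toAdditive := fun m n h => by
    have : m.toMul * (σ 1 1)⁻¹ = n.toMul * (σ 1 1)⁻¹ := congrArg CocycleExtension.snd h
    exact Additive.toMul.injective (mul_right_cancel this)
  obtain ⟨φ, hφ⟩ := (Module.Baer.of_divisible (Additive M)).extension_property_addMonoidHom
    ι.toAdditive hι (AddMonoidHom.id _)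
  have hφ' : ∀ m : M, φ (Additive.ofMul (ι m)) = Additive.ofMul m := fun m =>
    DFunLike.congr_fun hφ (Additive.ofMul m)
  refine ⟨fun x => (φ (Additive.ofMul ⟨x, 1⟩)).toMul, fun x y => ?_⟩
  have key : (⟨x, 1⟩ * ⟨y, 1⟩ : CocycleExtension σ) = ι (σ x y) * ⟨x * y, 1⟩ := by
    rw [mul_comm (ι _)]
    refine congrArg₂ CocycleExtension.mk (mul_one _).symm ?_
    change 1 * 1 * σ x y = 1 * (σ x y * (σ 1 1)⁻¹) * σ (x * y) 1
    rw [h1 (x * y), one_mul, one_mul, one_mul, inv_mul_cancel_right]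
  have := congrArg (fun e => (φ (Additive.ofMul e)).toMul) key
  simpa [hφ'] using this.symm

/-- The multiplicative group of an algebraically closed field is divisible. -/
lemma nonempty_divisibleBy_units (k : Type*) [Field k] [IsAlgClosed k] :
    Nonempty (DivisibleBy (Additive kˣ) ℤ) := by
  refine ⟨AddCommGroup.divisibleByIntOfSMulTopEqTop _ fun {n} hn => ?_⟩
  rw [eq_top_iff]
  intro x _
  have hn' : n.natAbs ≠ 0 := Int.natAbs_ne_zero.2 hn
  obtain ⟨z, hz⟩ := IsAlgClosed.exists_pow_nat_eq (x.toMul : k) (Nat.pos_of_ne_zero hn')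
  have hz0 : z ≠ 0 := fun h => x.toMul.ne_zero (by rw [← hz, h, zero_pow hn'])
  have hu : Units.mk0 z hz0 ^ n.natAbs = x.toMul := Units.ext (by simpa using hz)
  rcases Int.natAbs_eq n with h | h
  · refine AddSubgroup.mem_smul_pointwise_iff_exists _ _ _ |>.2
      ⟨Additive.ofMul (Units.mk0 z hz0), trivial, ?_⟩
    apply Additive.toMul.injective
    rw [h, toMul_zsmul, toMul_ofMul, zpow_natCast, hu]
  · refine AddSubgroup.mem_smul_pointwise_iff_exists _ _ _ |>.2
      ⟨Additive.ofMul (Units.mk0 z hz0)⁻¹, trivial, ?_⟩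
    apply Additive.toMul.injective
    rw [h, toMul_zsmul, toMul_ofMul, zpow_neg, inv_zpow', zpow_neg, inv_inv, zpow_natCast, hu]

namespace TwistedRep

variable {k H V : Type*} [Field k] [Group H] [AddCommGroup V] [Module k V]
variable (R : TwistedRep k H V)

lemma pairing_pow_card [Nontrivial V] {A : Subgroup H} (hcomm : ∀ a ∈ A, ∀ b ∈ A, Commute a b)
    {x y : H} (hx : x ∈ A) (hy : y ∈ A) : R.pairing x y ^ Nat.card A = 1 := by
  have h : (⟨x, hx⟩ : A) ^ Nat.card A = 1 := pow_card_eq_one'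
  have := congrArg (R.pairingHom A A hcomm) h
  rw [map_pow, map_one] at this
  exact DFunLike.congr_fun this ⟨y, hy⟩

/-- For an elementwise commuting subgroup of odd order, the operators can be rescaled so that
their cocycle becomes a square root of the commutator pairing (Baer's trick). Here `t` is an inverse
of two modulo the order of the subgroup. -/
lemma exists_rescaling [Nontrivial V] [IsAlgClosed k] {A : Subgroup H}
    (hcomm : ∀ a ∈ A, ∀ b ∈ A, Commute a b) {t : ℕ} (ht : Nat.card A + 1 = 2 * t) :
    ∃ ν : H → kˣ, ∀ x ∈ A, ∀ y ∈ A, ((ν x : k) • R.op x) * ((ν y : k) • R.op y) =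
      ((R.pairing x y ^ t : kˣ) : k) • ((ν (x * y) : k) • R.op (x * y)) := by
  classical
  obtain ⟨hdiv⟩ := nonempty_divisibleBy_units k
  obtain ⟨μ, hμ⟩ := exists_coboundary
    (fun x y : A => R.cocycle x y * (R.pairing x y ^ t)⁻¹)
    (fun x y => Subtype.ext (hcomm x x.2 y y.2)) (fun x y => by
      have h1 : R.pairing x y ^ (2 * t) = R.pairing x y := by
        rw [← ht, pow_succ, R.pairing_pow_card hcomm x.2 y.2, one_mul]
      have h2 : R.cocycle x y = R.pairing x y * R.cocycle y x := by simp [pairing]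
      rw [R.pairing_swap x y, inv_pow, inv_inv, h2]
      nth_rewrite 1 [← h1]
      rw [two_mul, pow_add, mul_right_comm, mul_inv_cancel_right, mul_comm]) (fun x y z => by
      have hxy : Commute (x : H) y := hcomm x x.2 y y.2
      have hxz : Commute (x : H) z := hcomm x x.2 z z.2
      have hyz : Commute (y : H) z := hcomm y y.2 z z.2
      rw [Subgroup.coe_mul, Subgroup.coe_mul, R.pairing_mul_left hxz hyz,
        R.pairing_mul_right hxy hxz, mul_mul_mul_comm, R.cocycle_mul_cocycle]
      have aux : ∀ a b c d e : kˣ, a * b * (c⁻¹ * (d * e)⁻¹) = a * e⁻¹ * (b * (c * d)⁻¹) := by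
        intro a b c d e
        simp only [mul_inv, mul_assoc, mul_comm, mul_left_comm]
      rw [mul_pow, mul_pow]
      exact aux _ _ _ _ _)
  refine ⟨fun x => if h : x ∈ A then (μ ⟨x, h⟩)⁻¹ else 1, fun x hx y hy => ?_⟩
  have hxy := hμ ⟨x, hx⟩ ⟨y, hy⟩
  simp only [dif_pos hx, dif_pos hy, dif_pos (mul_mem hx hy)]
  rw [smul_mul_smul_comm, R.op_mul, smul_smul, smul_smul, ← Units.val_mul, ← Units.val_mul,
    ← Units.val_mul, ← mul_inv]
  congr 2
  change _ * μ ⟨x * y, mul_mem hx hy⟩ = _ at hxy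
  rw [← hxy]
  simp [mul_comm, mul_left_comm]

/-- A nondegenerate normal abelian subgroup of odd order has a complement: the stabilizer of a
family of operators as in `exists_rescaling`. This is a Frattini argument, since the subgroup
itself permutes these families transitively by conjugation. -/
lemma Nondeg.exists_complement [Nontrivial V] [IsAlgClosed k] [Finite H] {A : Subgroup H}
    [hn : A.Normal] (hA : R.Nondeg A) (hcomm : ∀ a ∈ A, ∀ b ∈ A, Commute a b)
    (hodd : Odd (Nat.card A)) : ∃ K : Subgroup H, K ⊔ A = ⊤ ∧ K ⊓ A = ⊥ := by
  obtain ⟨t, ht⟩ : ∃ t, Nat.card A + 1 = 2 * t := by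
    obtain ⟨s, hs⟩ := hodd
    exact ⟨s + 1, by omega⟩
  obtain ⟨ν, hν⟩ := R.exists_rescaling hcomm ht
  obtain ⟨s, hs⟩ : ∃ s : H → Module.End k V, ∀ x, s x = (ν x : k) • R.op x := ⟨_, fun _ => rfl⟩
  simp only [← hs] at hν
  have hsu : ∀ x, IsUnit (s x) := fun x => by
    rw [hs]
    exact (R.isUnit_op x).smul (ν x)
  have hconj : ∀ h x, ∃ a : kˣ, R.op h * s x = (a : k) • (s (h * x * h⁻¹) * R.op h) := by
    intro h x
    obtain ⟨a, ha⟩ := R.exists_op_mul_eq_conj h x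
    refine ⟨ν x * a * (ν (h * x * h⁻¹))⁻¹, ?_⟩
    simp only [hs]
    rw [mul_smul_comm, ha, smul_mul_assoc, smul_smul, smul_smul, ← Units.val_mul, ← Units.val_mul,
      inv_mul_cancel_right]
  choose χ hχ using hconj
  have hχmul : ∀ h, ∀ x ∈ A, ∀ y ∈ A, χ h (x * y) = χ h x * χ h y := by
    intro h x hx y hy
    have hx' := hn.conj_mem x hx h
    have hy' := hn.conj_mem y hy h
    have h1 : R.op h * (s x * s y) = ((χ h x : k) * χ h y) •
        (s (h * x * h⁻¹) * s (h * y * h⁻¹) * R.op h) := by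
      rw [← mul_assoc, hχ, smul_mul_assoc, mul_assoc, hχ, mul_smul_comm, smul_smul, mul_assoc (s _)]
    have h2 : h * x * h⁻¹ * (h * y * h⁻¹) = h * (x * y) * h⁻¹ := by group
    have hne := (hsu (h * (x * y) * h⁻¹)).mul (R.isUnit_op h)
    rw [hν x hx y hy, hν _ hx' _ hy', R.pairing_conj (hcomm x hx y hy), mul_smul_comm] at h1
    rw [hχ, smul_mul_assoc, smul_comm (χ h x * χ h y : k), h2] at h1
    have h3 := smul_isUnit_cancel hne (smul_right_injective _ (Units.ne_zero _) h1)
    exact Units.ext (by simpa using h3)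
  let K : Subgroup H :=
    { carrier := {h | ∀ x ∈ A, R.op h * s x = s (h * x * h⁻¹) * R.op h}
      one_mem' := fun x _ => by simp [R.op_one]
      mul_mem' := fun {g h} hg hh x hx => by
        have h1 : R.op g * (R.op h * s x) =
            s (g * (h * x * h⁻¹) * g⁻¹) * (R.op g * R.op h) := by
          rw [hh x hx, ← mul_assoc, hg _ (hn.conj_mem x hx h), mul_assoc]
        rw [← mul_assoc, R.op_mul, smul_mul_assoc, mul_smul_comm] at h1
        have h2 := smul_right_injective _ (Units.ne_zero _) h1
        rw [show g * h * x * (g * h)⁻¹ = g * (h * x * h⁻¹) * g⁻¹ by group]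
        exact h2
      inv_mem' := fun {h} hh x hx => by
        have hx' : h⁻¹ * x * h ∈ A := by simpa using hn.conj_mem x hx h⁻¹
        have h1 := hh _ hx'
        rw [show h * (h⁻¹ * x * h) * h⁻¹ = x by group] at h1
        rw [inv_inv]
        apply (R.isUnit_op h).mul_right_injective
        dsimp only
        rw [← mul_assoc, R.op_mul_inv, ← mul_assoc, h1, mul_assoc, R.op_mul_inv, smul_mul_assoc,
          one_mul, mul_smul_comm, mul_one] }
  refine ⟨K, ?_, ?_⟩
  · rw [eq_top_iff]
    intro h _
    obtain ⟨y, hy, hyχ⟩ := hA.exists_pairing_eq R hcomm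
      (MonoidHom.mk' (fun x : A => χ h x) fun x z => hχmul h x x.2 z z.2)
    have hK : h * y⁻¹ ∈ K := by
      intro x hx
      have hxy : Commute y⁻¹ x := (hcomm y hy x hx).inv_left
      have h1 : R.op y⁻¹ * s x = (R.pairing y⁻¹ x : k) • (s x * R.op y⁻¹) := by
        simp only [hs]
        rw [mul_smul_comm, R.op_mul_of_commute hxy, smul_mul_assoc, smul_comm]
      have h2 : R.pairing y⁻¹ x * χ h x = 1 := by
        have := hyχ ⟨x, hx⟩
        simp only [MonoidHom.mk'_apply] at this
        rw [this, R.pairing_inv_left (hcomm y hy x hx), inv_mul_cancel]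
      have h3 : R.op h * R.op y⁻¹ * s x = s (h * x * h⁻¹) * (R.op h * R.op y⁻¹) := by
        rw [mul_assoc, h1, mul_smul_comm, ← mul_assoc, hχ, smul_mul_assoc, smul_smul,
          ← Units.val_mul, h2, Units.val_one, one_smul, mul_assoc]
      rw [R.op_mul, smul_mul_assoc, mul_smul_comm] at h3
      have h4 := smul_right_injective _ (Units.ne_zero _) h3
      rw [show h * y⁻¹ * x * (h * y⁻¹)⁻¹ = h * (y⁻¹ * x * y) * h⁻¹ by group,
        show y⁻¹ * x * y = x by rw [hxy.eq, inv_mul_cancel_right]]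
      exact h4
    rw [show h = h * y⁻¹ * y by group]
    exact mul_mem (Subgroup.mem_sup_left hK) (Subgroup.mem_sup_right hy)
  · rw [eq_bot_iff]
    rintro y ⟨hyK, hyA⟩
    refine hA y hyA fun x hx => ?_
    have h1 := hyK x hx
    have hxy := hcomm y hyA x hx
    rw [show y * x * y⁻¹ = x by rw [hxy.eq, mul_inv_cancel_right]] at h1
    rw [R.pairing_eq_one_iff hxy]
    simp only [hs] at h1
    rw [mul_smul_comm, smul_mul_assoc] at h1
    exact smul_right_injective _ (Units.ne_zero _) h1

end TwistedRep

/-! ### Joint eigenspaces -/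

section Eigenspaces

variable {k V : Type*} [Field k] [AddCommGroup V] [Module k V]

/-- An operator that preserves a nonzero subspace has an eigenvector in it. -/
lemma exists_inf_eigenspace_ne_bot [IsAlgClosed k] [FiniteDimensional k V] (f : Module.End k V)
    {W : Submodule k V} (hW : W ≠ ⊥) (hf : ∀ w ∈ W, f w ∈ W) :
    ∃ c : k, W ⊓ f.eigenspace c ≠ ⊥ := by
  have : Nontrivial W := Submodule.nontrivial_iff_ne_bot.2 hW
  obtain ⟨c, hc⟩ := Module.End.exists_eigenvalue (f.restrict hf)
  obtain ⟨v, hv⟩ := hc.exists_hasEigenvector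
  refine ⟨c, fun h => hv.2 (Subtype.ext ?_)⟩
  have h1 : f v = c • (v : V) := by simpa using congrArg Subtype.val hv.apply_eq_smul
  have h2 : (v : V) ∈ W ⊓ f.eigenspace c := ⟨v.2, Module.End.mem_eigenspace_iff.2 h1⟩
  rw [h] at h2
  simpa using h2

lemma exists_iInf_eigenspace_ne_bot [IsAlgClosed k] [FiniteDimensional k V] [Nontrivial V]
    {ι : Type*} (f : ι → Module.End k V) (hf : ∀ i j, Commute (f i) (f j)) :
    ∃ χ : ι → k, ⨅ i, (f i).eigenspace (χ i) ≠ ⊥ := by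
  suffices h : ∀ n, ∀ W : Submodule k V, Module.finrank k W = n → W ≠ ⊥ →
      (∀ i, ∀ w ∈ W, f i w ∈ W) → ∃ χ : ι → k, ⨅ i, (f i).eigenspace (χ i) ≠ ⊥ from
    h _ ⊤ rfl top_ne_bot fun _ _ _ => trivial
  intro n
  induction n using Nat.strong_induction_on with
  | _ n ih =>
    intro W hn hW hWf
    by_cases h : ∀ i, ∃ c, W ≤ (f i).eigenspace c
    · choose χ hχ using h
      exact ⟨χ, fun h0 => hW (le_bot_iff.1 (h0 ▸ le_iInf hχ))⟩
    · push Not at h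
      obtain ⟨i, hi⟩ := h
      obtain ⟨c, hc⟩ := exists_inf_eigenspace_ne_bot (f i) hW (hWf i)
      refine ih _ ?_ (W ⊓ (f i).eigenspace c) rfl hc fun j w hw => ⟨hWf j w hw.1, ?_⟩
      · rw [← hn]
        exact Submodule.finrank_lt_finrank_of_lt (inf_lt_left.2 (hi c))
      · have h1 := Module.End.mem_eigenspace_iff.1 hw.2
        apply Module.End.mem_eigenspace_iff.2
        rw [← Module.End.mul_apply, (hf i j).eq, Module.End.mul_apply, h1, map_smul]

lemma iSupIndep_iInf_eigenspace {ι : Type*} (f : ι → Module.End k V)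
    (hf : ∀ i j, Commute (f i) (f j)) :
    iSupIndep fun χ : ι → k => ⨅ i, (f i).eigenspace (χ i) := by
  refine (Module.End.independent_iInf_maxGenEigenspace_of_forall_mapsTo f
    fun i j φ => Module.End.mapsTo_maxGenEigenspace_of_comm (hf j i) φ).mono fun χ => ?_
  exact iInf_mono fun i => (Module.End.genEigenspace (f i) (χ i)).mono le_top

lemma sum_finrank_le_of_iSupIndep [FiniteDimensional k V] {ι : Type*} [Fintype ι]
    {U : ι → Submodule k V} (hU : iSupIndep U) :
    ∑ i, Module.finrank k (U i) ≤ Module.finrank k V := by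
  classical
  rw [← Module.finrank_directSum k (fun i => U i)]
  exact LinearMap.finrank_le_finrank_of_injective (iSupIndep.dfinsupp_lsum_injective hU)

/-- If `s` pairwise commuting families of operators preserve `W ≠ 0` and each of them acts by
nonscalars on every nonzero subspace that it preserves, then `s + 1 ≤ dim W`: passing to an
eigenspace of one operator lowers the dimension and loses only one family. -/
lemma card_add_one_le_finrank [IsAlgClosed k] [FiniteDimensional k V] {ι : Type*} (s : Finset ι)
    (S : ι → Set (Module.End k V))
    (hcomm : ∀ i ∈ s, ∀ j ∈ s, i ≠ j → ∀ a ∈ S i, ∀ b ∈ S j, Commute a b)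
    (hns : ∀ i ∈ s, ∀ U : Submodule k V, U ≠ ⊥ → (∀ a ∈ S i, ∀ u ∈ U, a u ∈ U) →
      ∃ a ∈ S i, ∀ c, ¬ U ≤ a.eigenspace c)
    (W : Submodule k V) (hW : W ≠ ⊥) (hWS : ∀ i ∈ s, ∀ a ∈ S i, ∀ w ∈ W, a w ∈ W) :
    s.card + 1 ≤ Module.finrank k W := by
  classical
  induction s using Finset.induction_on generalizing W with
  | empty => simpa [Nat.one_le_iff_ne_zero] using hW
  | insert i s his ih =>
    have hi := Finset.mem_insert_self i s
    obtain ⟨a, ha, hac⟩ := hns i hi W hW (hWS i hi)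
    obtain ⟨c, hc⟩ := exists_inf_eigenspace_ne_bot a hW (hWS i hi a ha)
    have h1 := ih (fun j hj l hl => hcomm j (Finset.mem_insert_of_mem hj) l
        (Finset.mem_insert_of_mem hl)) (fun j hj => hns j (Finset.mem_insert_of_mem hj))
      (W ⊓ a.eigenspace c) hc fun j hj b hb w hw =>
        ⟨hWS j (Finset.mem_insert_of_mem hj) b hb w hw.1, by
          have hab : Commute a b := hcomm i hi j (Finset.mem_insert_of_mem hj)
            (fun h => his (h ▸ hj)) a ha b hb
          have h1 := Module.End.mem_eigenspace_iff.1 hw.2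
          apply Module.End.mem_eigenspace_iff.2
          rw [← Module.End.mul_apply, hab.eq, Module.End.mul_apply, h1, map_smul]⟩
    have h2 := Submodule.finrank_lt_finrank_of_lt (inf_lt_left.2 (hac c))
    rw [Finset.card_insert_of_notMem his]
    omega

end Eigenspaces

namespace TwistedRep

variable {k H V : Type*} [Field k] [Group H] [AddCommGroup V] [Module k V]
variable (R : TwistedRep k H V)

/-- The subspace on which the elements `a` of `A` act as the scalars `χ a`. -/
def weightSpace (A : Subgroup H) (χ : A → k) : Submodule k V :=
  ⨅ a : A, (R.op a).eigenspace (χ a)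

variable {R}

lemma mem_weightSpace {A : Subgroup H} {χ : A → k} {v : V} :
    v ∈ R.weightSpace A χ ↔ ∀ a : A, R.op a v = χ a • v := by
  simp [weightSpace]

lemma eq_of_mem_weightSpace {A : Subgroup H} {χ ψ : A → k} {v : V} (hv : v ≠ 0)
    (h1 : v ∈ R.weightSpace A χ) (h2 : v ∈ R.weightSpace A ψ) : χ = ψ := by
  funext a
  refine smul_left_injective k hv ?_
  change χ a • v = ψ a • v
  rw [← mem_weightSpace.1 h1, ← mem_weightSpace.1 h2]

/-- The operators permute the weight spaces of a normal subgroup. -/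
lemma exists_op_mem_weightSpace {A : Subgroup H} [hn : A.Normal] (h : H) (χ : A → k) :
    ∃ ψ : A → k, ∀ v ∈ R.weightSpace A χ, R.op h v ∈ R.weightSpace A ψ := by
  have hconj := fun a : A => R.exists_op_mul_eq_conj h (h⁻¹ * a * h)
  choose z hz using hconj
  have hmem : ∀ a : A, h⁻¹ * a * h ∈ A := fun a => by simpa using hn.conj_mem a a.2 h⁻¹
  refine ⟨fun a => (z a : k)⁻¹ * χ ⟨_, hmem a⟩, fun v hv => mem_weightSpace.2 fun a => ?_⟩
  have h1 := LinearMap.congr_fun (hz a) v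
  rw [show h * (h⁻¹ * a * h) * h⁻¹ = (a : H) by group, LinearMap.smul_apply, Module.End.mul_apply,
    Module.End.mul_apply, mem_weightSpace.1 hv ⟨_, hmem a⟩, map_smul] at h1
  rw [mul_smul, h1, smul_smul, inv_mul_cancel₀ (Units.ne_zero _), one_smul]

lemma exists_map_weightSpace_eq {A : Subgroup H} [A.Normal] (h : H) {χ : A → k}
    (hχ : R.weightSpace A χ ≠ ⊥) :
    ∃ ψ : A → k, (R.weightSpace A χ).map (R.op h) = R.weightSpace A ψ := by
  obtain ⟨ψ, hψ⟩ := exists_op_mem_weightSpace (R := R) h χ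
  obtain ⟨χ', hχ'⟩ := exists_op_mem_weightSpace (R := R) h⁻¹ ψ
  obtain ⟨v, hv, hv0⟩ := (Submodule.ne_bot_iff _).1 hχ
  have hback : ∀ w, R.op h⁻¹ (R.op h w) = (R.cocycle h⁻¹ h : k) • w := fun w => by
    rw [← Module.End.mul_apply, op_inv_mul]; rfl
  have hforth : ∀ w, R.op h (R.op h⁻¹ w) = (R.cocycle h h⁻¹ : k) • w := fun w => by
    rw [← Module.End.mul_apply, op_mul_inv]; rfl
  have : χ = χ' := by
    refine eq_of_mem_weightSpace hv0 hv ?_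
    have h1 := hχ' _ (hψ v hv)
    rw [hback] at h1
    exact (Submodule.smul_mem_iff _ (Units.ne_zero _)).1 h1
  subst this
  refine ⟨ψ, le_antisymm (Submodule.map_le_iff_le_comap.2 hψ) fun w hw => ?_⟩
  refine ⟨(R.cocycle h h⁻¹ : k)⁻¹ • R.op h⁻¹ w, Submodule.smul_mem _ _ (hχ' w hw), ?_⟩
  rw [map_smul, hforth, smul_smul, inv_mul_cancel₀ (Units.ne_zero _), one_smul]

/-- Clifford theory for a primitive faithful projective representation: a normal subgroup whose
operators commute acts by scalars, because its weight spaces form a system of imprimitivity. -/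
lemma Primitive.eq_bot_of_commute [IsAlgClosed k] [FiniteDimensional k V] (hp : R.Primitive)
    (hi : R.Irreducible) (hf : R.Faithful) {A : Subgroup H} [A.Normal]
    (hA : ∀ a ∈ A, ∀ b ∈ A, Commute (R.op a) (R.op b)) : A = ⊥ := by
  classical
  have := hi.1
  have hcomm : ∀ a b : A, Commute (R.op a) (R.op b) := fun a b => hA a a.2 b b.2
  have hind : iSupIndep (R.weightSpace A) := iSupIndep_iInf_eigenspace (fun a : A => R.op a) hcomm
  obtain ⟨χ₀, hχ₀⟩ : ∃ χ, R.weightSpace A χ ≠ ⊥ :=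
    exists_iInf_eigenspace_ne_bot (fun a : A => R.op a) hcomm
  have htop : ⨆ χ, R.weightSpace A χ = ⊤ := by
    refine (hi.2 _ fun h _ w hw => ?_).resolve_left
      fun h => hχ₀ (le_bot_iff.1 (h ▸ le_iSup (R.weightSpace A) χ₀))
    have : (⨆ χ, R.weightSpace A χ).map (R.op h) ≤ ⨆ χ, R.weightSpace A χ := by
      rw [Submodule.map_iSup]
      refine iSup_le fun χ => ?_
      obtain ⟨ψ, hψ⟩ := exists_op_mem_weightSpace (R := R) h χ
      exact (Submodule.map_le_iff_le_comap.2 hψ).trans (le_iSup (R.weightSpace A) ψ)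
    exact this ⟨w, hw, rfl⟩
  let I := {χ : A → k // R.weightSpace A χ ≠ ⊥}
  let : Fintype I := hind.fintypeNeBotOfFiniteDimensional
  have hindI : iSupIndep fun i : I => R.weightSpace A i := hind.comp Subtype.val_injective
  have htopI : ⨆ i : I, R.weightSpace A i = ⊤ := by
    rw [← htop]
    refine le_antisymm (iSup_le fun i => le_iSup (R.weightSpace A) i) (iSup_le fun χ => ?_)
    by_cases h : R.weightSpace A χ = ⊥
    · rw [h]; exact bot_le
    · exact le_iSup (fun i : I => R.weightSpace A i) ⟨χ, h⟩
  have hinjI : Function.Injective fun i : I => R.weightSpace A i := fun i j hij => by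
    obtain ⟨v, hv, hv0⟩ := (Submodule.ne_bot_iff _).1 i.2
    exact Subtype.ext (eq_of_mem_weightSpace hv0 hv (by dsimp only at hij; rwa [← hij]))
  have hperm : ∀ h, ∃ σ : Equiv.Perm I, ∀ i : I,
      (R.weightSpace A i).map (R.op h) = R.weightSpace A (σ i).1 := by
    intro h
    have h1 : ∀ i : I, ∃ j : I, (R.weightSpace A i).map (R.op h) = R.weightSpace A j := by
      intro i
      obtain ⟨ψ, hψ⟩ := exists_map_weightSpace_eq (R := R) h i.2
      refine ⟨⟨ψ, fun h0 => i.2 ?_⟩, hψ⟩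
      rw [h0] at hψ
      exact Submodule.map_injective_of_injective (R.op_injective h) (hψ.trans (Submodule.map_bot _).symm)
    choose σ hσ using h1
    have hσi : Function.Injective σ := fun i j hij => by
      refine hinjI (Submodule.map_injective_of_injective (R.op_injective h) ?_)
      rw [hσ, hσ, hij]
    exact ⟨Equiv.ofBijective σ (Finite.injective_iff_bijective.1 hσi), hσ⟩
  let e := Fintype.equivFin I
  have hr := hp (Fintype.card I) (fun i => R.weightSpace A (e.symm i)) (fun i => (e.symm i).2)
    ((DirectSum.isInternal_submodule_iff_iSupIndep_and_iSup_eq_top _).2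
      ⟨hindI.comp e.symm.injective, by
        rw [← htopI]; exact e.symm.iSup_comp (g := fun i : I => R.weightSpace A i)⟩) fun h => by
    obtain ⟨σ, hσ⟩ := hperm h
    exact ⟨(e.symm.trans σ).trans e, fun i => by simpa using hσ (e.symm i)⟩
  have hsub : Subsingleton I := Fintype.card_le_one_iff_subsingleton.1 hr
  have htop' : R.weightSpace A χ₀ = ⊤ := by
    rw [← htopI]
    refine le_antisymm (le_iSup (fun i : I => R.weightSpace A i) ⟨χ₀, hχ₀⟩) (iSup_le fun i => ?_)
    rw [Subsingleton.elim i ⟨χ₀, hχ₀⟩]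
  rw [eq_bot_iff]
  intro a ha
  refine hf a (χ₀ ⟨a, ha⟩) (LinearMap.ext fun v => ?_)
  exact mem_weightSpace.1 (htop' ▸ Submodule.mem_top : v ∈ R.weightSpace A χ₀) ⟨a, ha⟩

/-- In a primitive faithful projective representation the commutator pairing of every normal
abelian subgroup is nondegenerate. -/
lemma Primitive.nondeg [IsAlgClosed k] [FiniteDimensional k V] (hp : R.Primitive)
    (hi : R.Irreducible) (hf : R.Faithful) {A : Subgroup H} [hn : A.Normal]
    (hcomm : ∀ a ∈ A, ∀ b ∈ A, Commute a b) : R.Nondeg A := by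
  have := hi.1
  let B : Subgroup H := R.perp A A hcomm
  have hB : B.Normal := ⟨fun x hx h => ⟨hn.conj_mem x hx.1 h, fun y hy => by
    have hy' : h⁻¹ * y * h ∈ A := by simpa using hn.conj_mem y hy h⁻¹
    have := R.pairing_conj (hcomm x hx.1 _ hy') h
    rw [show h * (h⁻¹ * y * h) * h⁻¹ = y by group] at this
    rw [this, hx.2 _ hy']⟩⟩
  have hbot : B = ⊥ := hp.eq_bot_of_commute hi hf fun a ha b hb =>
    (R.pairing_eq_one_iff (hcomm a ha.1 b hb.1)).1 (ha.2 b hb.1)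
  intro x hx hxy
  have : x ∈ B := ⟨hx, hxy⟩
  rwa [hbot, Subgroup.mem_bot] at this

/-- Let the pairing be nondegenerate on the abelian subgroup `N`. If every nonzero subspace
preserved by the operators that commute with those of `N` has dimension at least `f`, then
`f ^ 2 * |N| ≤ (dim V) ^ 2`: for a maximal isotropic subgroup `L` of `N`, the elements of `N`
permute the weight spaces of `L`, which yields `|N / L| ≥ |L|` of them. -/
lemma Nondeg.sq_mul_card_le [IsAlgClosed k] [FiniteDimensional k V] [Nontrivial V] [Finite H]
    {N : Subgroup H} (hN : R.Nondeg N) (hcomm : ∀ a ∈ N, ∀ b ∈ N, Commute a b) (f : ℕ)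
    (hf : ∀ W : Submodule k V, W ≠ ⊥ →
      R.Stable {d | ∀ x ∈ N, Commute (R.op d) (R.op x)} W → f ≤ Module.finrank k W) :
    f ^ 2 * Nat.card N ≤ Module.finrank k V ^ 2 := by
  classical
  obtain ⟨L, hL⟩ : ∃ L, Maximal (fun L : Subgroup H =>
      L ≤ N ∧ ∀ x ∈ L, ∀ y ∈ L, R.pairing x y = 1) L :=
    (Set.toFinite {L : Subgroup H | L ≤ N ∧ ∀ x ∈ L, ∀ y ∈ L, R.pairing x y = 1}).exists_maximal
      ⟨⊥, bot_le, fun x hx y _ => by rw [Subgroup.mem_bot.1 hx, R.pairing_one_left]⟩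
  obtain ⟨hLN, hLL⟩ := hL.prop
  have hself : ∀ x ∈ N, (∀ y ∈ L, R.pairing x y = 1) → x ∈ L := by
    intro x hx hxL
    have hcommS : ∀ S : Set H, S ⊆ N → ∀ a ∈ N, ∀ s ∈ S, Commute a s :=
      fun S hS a ha s hs => hcomm a ha s (hS hs)
    let S : Set H := insert x (L : Set H)
    have hSN : S ⊆ N := Set.insert_subset hx hLN
    have hSS : ∀ a ∈ S, ∀ b ∈ S, R.pairing a b = 1 := by
      rintro a (rfl | ha) b (rfl | hb)
      · exact R.pairing_self _
      · exact hxL b hb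
      · rw [R.pairing_swap, hxL a ha, inv_one]
      · exact hLL a ha b hb
    have hcN : Subgroup.closure S ≤ N := (Subgroup.closure_le _).2 hSN
    have h1 : Subgroup.closure S ≤ R.perp N S (hcommS S hSN) :=
      (Subgroup.closure_le _).2 fun a ha => ⟨hSN ha, hSS a ha⟩
    have h2 : Subgroup.closure S ≤ R.perp N (Subgroup.closure S) (hcommS _ hcN) :=
      (Subgroup.closure_le _).2 fun a ha => ⟨hSN ha, fun b hb => by
        rw [R.pairing_swap, (h1 hb).2 a ha, inv_one]⟩
    exact hL.le_of_ge ⟨hcN, fun a ha b hb => (h2 ha).2 b hb⟩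
      (fun y hy => Subgroup.subset_closure (Set.mem_insert_of_mem _ hy))
      (Subgroup.subset_closure (Set.mem_insert _ _))
  have hNL : ∀ a ∈ N, ∀ b ∈ L, Commute a b := fun a ha b hb => hcomm a ha b (hLN hb)
  have hLcomm : ∀ a b : L, Commute (R.op a) (R.op b) := fun a b =>
    (R.pairing_eq_one_iff (hcomm a (hLN a.2) b (hLN b.2))).1 (hLL a a.2 b b.2)
  let Ψ := R.pairingHom N L hNL
  have hker : Nat.card Ψ.ker = Nat.card L := by
    refine Nat.card_congr ⟨fun x => ⟨x.1, hself x.1 x.1.2 fun y hy => ?_⟩,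
      fun y => ⟨⟨y, hLN y.2⟩, ?_⟩, fun _ => rfl, fun _ => rfl⟩
    · exact DFunLike.congr_fun (MonoidHom.mem_ker.1 x.2) (⟨y, hy⟩ : L)
    · exact MonoidHom.mem_ker.2 (MonoidHom.ext fun z => hLL y y.2 z z.2)
  have hcardN : Nat.card N = Nat.card Ψ.range * Nat.card L := by
    rw [← hker, ← Subgroup.index_ker, mul_comm, Subgroup.card_mul_index]
  have hLle : Nat.card L ≤ Nat.card Ψ.range := by
    obtain ⟨hfin, hcard⟩ := card_monoidHom_units_le Ψ.range k
    refine le_trans ?_ hcard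
    let ev : L → (Ψ.range →* kˣ) := fun a =>
      (MonoidHom.eval a : (L →* kˣ) →* kˣ).comp Ψ.range.subtype
    refine Nat.card_le_card_of_injective ev fun a b hab => ?_
    have h1 : ∀ x ∈ N, R.pairing x a = R.pairing x b := fun x hx =>
      DFunLike.congr_fun hab ⟨Ψ ⟨x, hx⟩, ⟨_, rfl⟩⟩
    have h2 : (a : H) * (b : H)⁻¹ = 1 := by
      refine hN _ (hLN (mul_mem a.2 (inv_mem b.2))) fun y hy => ?_
      have ha := hcomm a (hLN a.2) y hy
      have hb := hcomm b (hLN b.2) y hy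
      rw [R.pairing_mul_left ha hb.inv_left, R.pairing_inv_left hb, R.pairing_swap y a,
        R.pairing_swap y b, h1 y hy, mul_inv_cancel]
    exact Subtype.ext (mul_inv_eq_one.1 h2)
  obtain ⟨χ₀, hχ₀⟩ : ∃ χ, R.weightSpace L χ ≠ ⊥ :=
    exists_iInf_eigenspace_ne_bot (fun a : L => R.op a) hLcomm
  obtain ⟨v, hv, hv0⟩ := (Submodule.ne_bot_iff _).1 hχ₀
  -- The weight of `R.op x v` for `x` in `N`, as a function of the image of `x` in `Ψ.range`.
  let wt : Ψ.range → L → k := fun θ a => (((θ : L →* kˣ) a)⁻¹ : kˣ) * χ₀ a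
  have hχne : ∀ a, χ₀ a ≠ 0 := fun a h => by
    have h1 := mem_weightSpace.1 hv a
    rw [h, zero_smul] at h1
    exact hv0 (R.op_injective a (h1.trans (map_zero _).symm))
  have hwt : Function.Injective wt := fun θ θ' h => by
    refine Subtype.ext (MonoidHom.ext fun a => ?_)
    have := mul_right_cancel₀ (hχne a) (congrFun h a)
    exact inv_injective (Units.ext this)
  have hne : ∀ θ, R.weightSpace L (wt θ) ≠ ⊥ := by
    rintro ⟨_, ⟨x, rfl⟩⟩
    refine (Submodule.ne_bot_iff _).2 ⟨R.op x v, mem_weightSpace.2 fun a => ?_, fun h =>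
      hv0 (R.op_injective x (h.trans (map_zero _).symm))⟩
    rw [← Module.End.mul_apply, R.op_mul_of_commute (hNL x x.2 a a.2).symm, LinearMap.smul_apply,
      Module.End.mul_apply, mem_weightSpace.1 hv a, map_smul, smul_smul, R.pairing_swap]
    rfl
  have := Fintype.ofFinite Ψ.range
  have hind : iSupIndep fun θ => R.weightSpace L (wt θ) :=
    (iSupIndep_iInf_eigenspace (fun a : L => R.op a) hLcomm).comp hwt
  have hsum := sum_finrank_le_of_iSupIndep hind
  have hdim : ∀ θ, f ≤ Module.finrank k (R.weightSpace L (wt θ)) := fun θ =>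
    hf _ (hne θ) fun d hd w hw => mem_weightSpace.2 fun a => by
      rw [← Module.End.mul_apply, ← (hd a (hLN a.2)).eq, Module.End.mul_apply,
        mem_weightSpace.1 hw a, map_smul]
  have hle : Nat.card Ψ.range * f ≤ Module.finrank k V := by
    refine le_trans ?_ hsum
    rw [Nat.card_eq_fintype_card]
    simpa using Finset.sum_le_sum fun θ (_ : θ ∈ Finset.univ) => hdim θ
  calc f ^ 2 * Nat.card N = (f ^ 2 * Nat.card Ψ.range) * Nat.card L := by rw [hcardN, mul_assoc]
    _ ≤ (f ^ 2 * Nat.card Ψ.range) * Nat.card Ψ.range := Nat.mul_le_mul_left _ hLle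
    _ = (Nat.card Ψ.range * f) ^ 2 := by ring
    _ ≤ _ := Nat.pow_le_pow_left hle 2

end TwistedRep

/-! ### Simple groups -/

/-- A nonabelian simple group maps trivially to a monoid if the images of its elements commute. -/
lemma IsSimpleGroup.map_eq_one_of_commute {T N : Type*} [Group T] [IsSimpleGroup T] [Monoid N]
    (hT : ∃ a b : T, a * b ≠ b * a) (f : T →* N) (hf : ∀ a b, Commute (f a) (f b)) (t : T) :
    f t = 1 := by
  rcases f.normal_ker.eq_bot_or_eq_top with h | h
  · obtain ⟨a, b, hab⟩ := hT
    refine absurd ((f.ker_eq_bot_iff).1 h ?_) hab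
    rw [map_mul, map_mul, (hf a b).eq]
  · exact MonoidHom.mem_ker.1 (h ▸ Subgroup.mem_top t)

/-! ### Stable subspaces -/

section Stable

variable {F W : Type*} [Field F] [AddCommGroup W] [Module F W]

/-- The subspace `U` is preserved by all operators in `S`. -/
def StableUnder (S : Set (Module.End F W)) (U : Submodule F W) : Prop :=
  ∀ a ∈ S, ∀ u ∈ U, a u ∈ U

/-- `U` is minimal among the nonzero subspaces preserved by the operators in `S`. -/
def IsMinimalStable (S : Set (Module.End F W)) (U : Submodule F W) : Prop :=
  Minimal (fun U : Submodule F W => U ≠ ⊥ ∧ StableUnder S U) U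

lemma StableUnder.exists_minimal_le [FiniteDimensional F W] {S : Set (Module.End F W)}
    {U : Submodule F W} (hU : StableUnder S U) (h0 : U ≠ ⊥) : ∃ U' ≤ U, IsMinimalStable S U' :=
  exists_minimal_le_of_wellFoundedLT _ U ⟨h0, hU⟩

lemma IsMinimalStable.eq_of_le {S : Set (Module.End F W)} {U P : Submodule F W}
    (hU : IsMinimalStable S U) (hP : StableUnder S P) (h0 : P ≠ ⊥) (hle : P ≤ U) : P = U :=
  le_antisymm hle (hU.le_of_le ⟨h0, hP⟩ hle)

lemma StableUnder.inf {S : Set (Module.End F W)} {U P : Submodule F W} (hU : StableUnder S U)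
    (hP : StableUnder S P) : StableUnder S (U ⊓ P) :=
  fun a ha u hu => ⟨hU a ha u hu.1, hP a ha u hu.2⟩

/-- A nonabelian simple group that acts on a finite irreducible module by module endomorphisms acts
trivially, because these endomorphisms form a finite division ring, hence a field. -/
lemma IsMinimalStable.apply_eq_self [Finite W] {T : Type*} [Group T] [IsSimpleGroup T]
    (hT : ∃ a b : T, a * b ≠ b * a) {S : Set (Module.End F W)} {U : Submodule F W}
    (hU : IsMinimalStable S U) (f : T →* Module.End F W) (hfS : ∀ t, ∀ a ∈ S, Commute (f t) a)
    (hfU : ∀ t, ∀ u ∈ U, f t u ∈ U) (t : T) {u : W} (hu : u ∈ U) : f t u = u := by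
  -- `D` is the ring of endomorphisms of the irreducible module `U`.
  let S' : Set (Module.End F U) := {b | ∃ a ∈ S, ∀ u : U, ((b u : U) : W) = a u}
  let D := Subring.centralizer S'
  have : Finite (Module.End F U) := DFunLike.finite _
  have : Nontrivial U := Submodule.nontrivial_iff_ne_bot.2 hU.prop.1
  have hdom : IsDomain D := by
    have : NoZeroDivisors D := ⟨fun {x y} hxy => by
      by_contra! hne
      obtain ⟨hx, hy⟩ := hne
      have hstab : StableUnder S ((LinearMap.range (y : Module.End F U)).map U.subtype) := by
        rintro a ha _ ⟨_, ⟨v, rfl⟩, rfl⟩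
        let b : Module.End F U := a.restrict (hU.prop.2 a ha)
        have hb : b ∈ S' := ⟨a, ha, fun _ => rfl⟩
        have hyb := LinearMap.congr_fun (Subring.mem_centralizer_iff.1 y.2 b hb) v
        exact ⟨_, ⟨b v, rfl⟩, congrArg Subtype.val hyb.symm⟩
      have hne : (LinearMap.range (y : Module.End F U)).map U.subtype ≠ ⊥ := by
        intro h
        rw [← Submodule.map_bot U.subtype] at h
        have := Submodule.map_injective_of_injective U.injective_subtype h
        exact hy (Subtype.ext (LinearMap.range_eq_bot.1 this))
      have heq := hU.eq_of_le hstab hne (Submodule.map_subtype_le _ _)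
      refine hx (Subtype.ext (LinearMap.ext fun w => ?_))
      obtain ⟨_, ⟨v, rfl⟩, hv⟩ : (w : W) ∈ (LinearMap.range (y : Module.End F U)).map U.subtype :=
        heq.ge w.2
      rw [← Subtype.ext hv]
      exact LinearMap.congr_fun (congrArg Subtype.val hxy) v⟩
    exact NoZeroDivisors.to_isDomain D
  let g : T →* Module.End F U :=
    { toFun := fun t => (f t).restrict (hfU t)
      map_one' := by ext; simp
      map_mul' := fun a b => by ext; simp }
  have hg : ∀ t, g t ∈ D := fun t => Subring.mem_centralizer_iff.2 fun b hb => by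
    obtain ⟨a, ha, hab⟩ := hb
    ext v
    change ((b (g t v) : U) : W) = f t (b v)
    rw [hab, hab]
    exact (LinearMap.congr_fun (hfS t a ha).eq v).symm
  have h1 := IsSimpleGroup.map_eq_one_of_commute hT g (fun a b =>
    congrArg Subtype.val ((Finite.isDomain_to_isField D).mul_comm ⟨g a, hg a⟩ ⟨g b, hg b⟩)) t
  exact congrArg Subtype.val (LinearMap.congr_fun h1 (⟨u, hu⟩ : U))

end Stable

/-! ### Alternating forms -/

section Alternating

variable {F W : Type*} [Field F] [AddCommGroup W] [Module F W] [FiniteDimensional F W]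

/-- A space with a nondegenerate alternating form has even dimension: a maximal isotropic subspace
is its own orthogonal complement. -/
lemma LinearMap.IsAlt.even_finrank {B : LinearMap.BilinForm F W} (hB : LinearMap.IsAlt B)
    (hker : LinearMap.ker B = ⊥) : Even (Module.finrank F W) := by
  obtain ⟨L, hL⟩ : ∃ L, Maximal (fun L : Submodule F W => L ≤ B.orthogonal L) L :=
    exists_maximal_of_wellFoundedGT _ ⟨⊥, bot_le⟩
  have hsymm : ∀ x y, B x y = 0 → B y x = 0 := fun x y h => hB.isRefl x y h
  have hself : B.orthogonal L ≤ L := by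
    intro x hx
    refine hL.le_of_ge (y := L ⊔ F ∙ x) ?_ le_sup_left
      (Submodule.mem_sup_right (Submodule.mem_span_singleton_self x))
    intro y hy
    obtain ⟨a, ha, b, hb, rfl⟩ := Submodule.mem_sup.1 hy
    obtain ⟨c, rfl⟩ := Submodule.mem_span_singleton.1 hb
    intro z hz
    obtain ⟨a', ha', b', hb', rfl⟩ := Submodule.mem_sup.1 hz
    obtain ⟨c', rfl⟩ := Submodule.mem_span_singleton.1 hb'
    have h1 : B a' a = 0 := hL.prop ha a' ha'
    have h2 : B a' x = 0 := hx a' ha'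
    have h3 : B x a = 0 := hsymm _ _ (hx a ha)
    have h4 : B x x = 0 := hB x
    change B _ _ = 0
    simp [h1, h2, h3, h4]
  have heq : B.orthogonal L = L := le_antisymm hself hL.prop
  have := LinearMap.BilinForm.finrank_add_finrank_orthogonal' (B := B) L
  rw [heq, hker, inf_bot_eq, finrank_bot, add_zero] at this
  exact ⟨_, this.symm⟩

/-- Fong's lemma over the field of two elements: an irreducible module without fixed vectors that
carries a nonzero invariant bilinear form has even dimension. -/
lemma even_finrank_of_invariant_form {W : Type*} [AddCommGroup W] [Module (ZMod 2) W]
    [FiniteDimensional (ZMod 2) W] {T : Type*} [Group T] (f : Representation (ZMod 2) T W)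
    (hirr : ∀ P : Submodule (ZMod 2) W, (∀ t, ∀ p ∈ P, f t p ∈ P) → P = ⊥ ∨ P = ⊤)
    (hfix : ∀ w, (∀ t, f t w = w) → w = 0) (b : LinearMap.BilinForm (ZMod 2) W) (hb : b ≠ 0)
    (hinv : ∀ t u v, b (f t u) (f t v) = b u v) : Even (Module.finrank (ZMod 2) W) := by
  have key : ∀ a : LinearMap.BilinForm (ZMod 2) W, a ≠ 0 → LinearMap.IsAlt a →
      (∀ t u v, a (f t u) (f t v) = a u v) → Even (Module.finrank (ZMod 2) W) := by
    intro a ha halt hainv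
    refine halt.even_finrank ((hirr _ fun t p hp => ?_).resolve_right fun h =>
      ha (LinearMap.ker_eq_top.1 h))
    rw [LinearMap.mem_ker] at hp ⊢
    ext v
    have := hainv t p (f t⁻¹ v)
    rwa [← Module.End.mul_apply (f t), ← map_mul, mul_inv_cancel, map_one, hp] at this
  by_cases hsum : b + b.flip = 0
  · have hsymm : ∀ u v, b u v = b v u := fun u v => by
      have : b u v + b v u = 0 := LinearMap.congr_fun₂ hsum u v
      exact CharTwo.add_eq_zero.1 this
    -- As `b` is symmetric and the characteristic is two, the quadratic form of `b` is linear.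
    let q : W →ₗ[ZMod 2] ZMod 2 := AddMonoidHom.toZModLinearMap 2
      (AddMonoidHom.mk' (fun u => b u u) fun u v => by
        simp only [map_add, LinearMap.add_apply]
        rw [hsymm v u, add_assoc, ← add_assoc (b u v), CharTwo.add_self_eq_zero, zero_add])
    rcases hirr (LinearMap.ker q) (fun t p hp => by
      rw [LinearMap.mem_ker] at hp ⊢
      exact (hinv t p p).trans hp) with h | h
    · refine absurd (LinearMap.ext fun u => ?_) hb
      have hu : u = 0 := hfix u fun t => LinearMap.ker_eq_bot.1 h (hinv t u u)
      rw [hu, map_zero, map_zero]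
    · exact key b hb (fun u => LinearMap.mem_ker.1 (h ▸ Submodule.mem_top : u ∈ LinearMap.ker q))
        hinv
  · refine key _ hsum (fun u => CharTwo.add_self_eq_zero _) fun t u v => ?_
    simp [hinv]

/-- A faithful irreducible module of dimension `d` over the field of two elements gives an
irreducible embedding into `GL_d(2)`. -/
lemma embedsIrreduciblyGL2_of_representation {W : Type*} [AddCommGroup W] [Module (ZMod 2) W]
    [FiniteDimensional (ZMod 2) W] [Nontrivial W] {T : Type*} [Group T]
    (f : Representation (ZMod 2) T W) (hf : Function.Injective f)
    (hirr : ∀ P : Submodule (ZMod 2) W, (∀ t, ∀ p ∈ P, f t p ∈ P) → P = ⊥ ∨ P = ⊤) :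
    EmbedsIrreduciblyGL2 T (Module.finrank (ZMod 2) W) := by
  let e : W ≃ₗ[ZMod 2] (Fin (Module.finrank (ZMod 2) W) → ZMod 2) :=
    (Module.finBasis (ZMod 2) W).equivFun
  let g : T →* Matrix.GeneralLinearGroup (Fin (Module.finrank (ZMod 2) W)) (ZMod 2) :=
    (Matrix.GeneralLinearGroup.toLin.symm.toMonoidHom.comp
      (LinearMap.GeneralLinearGroup.congrLinearEquiv e).toMonoidHom).comp (MonoidHom.toHomUnits f)
  have hg : ∀ t v, natRep g.range ⟨g t, ⟨t, rfl⟩⟩ v = e (f t (e.symm v)) := by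
    intro t v
    have h1 : Matrix.GeneralLinearGroup.toLin (g t) =
        LinearMap.GeneralLinearGroup.congrLinearEquiv e (MonoidHom.toHomUnits f t) :=
      MulEquiv.apply_symm_apply _ _
    change (Matrix.GeneralLinearGroup.toLin (g t)).val v = _
    rw [h1]
    rfl
  refine ⟨g, ?_, ?_⟩
  · intro s t hst
    have h1 : MonoidHom.toHomUnits f s = MonoidHom.toHomUnits f t :=
      (LinearMap.GeneralLinearGroup.congrLinearEquiv e).injective
        (Matrix.GeneralLinearGroup.toLin.symm.injective hst)
    exact hf (congrArg Units.val h1)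
  · have hnt : Nontrivial (Fin (Module.finrank (ZMod 2) W) → ZMod 2) := e.symm.toEquiv.nontrivial
    have : Nontrivial (Subrepresentation (natRep g.range)) := by
      refine ⟨⊥, ⊤, fun h => ?_⟩
      have h1 : (⊥ : Submodule (ZMod 2) (Fin (Module.finrank (ZMod 2) W) → ZMod 2)) = ⊤ :=
        congrArg Subrepresentation.toSubmodule h
      exact bot_ne_top h1
    refine ⟨fun P => ?_⟩
    have h := hirr (P.toSubmodule.comap e.toLinearMap) fun t p hp => by
      have := P.apply_mem_toSubmodule ⟨g t, ⟨t, rfl⟩⟩ hp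
      rw [hg] at this
      simpa using this
    have hback : (P.toSubmodule.comap e.toLinearMap).map e.toLinearMap = P.toSubmodule :=
      Submodule.map_comap_eq_of_surjective e.surjective _
    rcases h with h | h
    · left
      refine Subrepresentation.toSubmodule_injective ?_
      rw [← hback, h, Submodule.map_bot]
      rfl
    · right
      refine Subrepresentation.toSubmodule_injective ?_
      rw [← hback, h, Submodule.map_top, LinearMap.range_eq_top.2 e.surjective]
      rfl

end Alternating

/-! ### Modules for powers of a simple group -/

section FactorOps

variable {ι T F W : Type*} [DecidableEq ι] [Group T] [Field F] [AddCommGroup W]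
  [Module F W]

/-- The operators of the elements in the `i`-th factors of `T ^ ι`, for `i` in `s`. -/
def factorOps (ρ : Representation F (ι → T) W) (s : Set ι) : Set (Module.End F W) :=
  {a | ∃ i ∈ s, ∃ t, a = ρ (Pi.mulSingle i t)}

lemma stableUnder_factorOps_iff {ρ : Representation F (ι → T) W} {s : Set ι}
    {U : Submodule F W} : StableUnder (factorOps ρ s) U ↔
      ∀ i ∈ s, ∀ t, ∀ u ∈ U, ρ (Pi.mulSingle i t) u ∈ U :=
  ⟨fun h i hi t => h _ ⟨i, hi, t, rfl⟩, by rintro h _ ⟨i, hi, t, rfl⟩; exact h i hi t⟩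

/-- If every `T i`-submodule of `U` that is minimal has dimension at least `q`, and no factor `T i`
with `i` in `s` has nonzero fixed vectors in `U`, then `q * |s| ≤ dim U`. By
`IsMinimalStable.apply_eq_self` a further factor cannot preserve an irreducible module for the other
factors, so it at least doubles the dimension. -/
lemma mul_card_le_finrank [Finite W] [IsSimpleGroup T] (hT : ∃ a b : T, a * b ≠ b * a)
    (ρ : Representation F (ι → T) W) (q : ℕ) (s : Finset ι) (U : Submodule F W) (hU0 : U ≠ ⊥)
    (hU : StableUnder (factorOps ρ s) U)
    (hfix : ∀ i ∈ s, ∀ u ∈ U, (∀ t, ρ (Pi.mulSingle i t) u = u) → u = 0)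
    (hq : ∀ i ∈ s, ∀ U' ≤ U, IsMinimalStable (factorOps ρ {i}) U' → q ≤ Module.finrank F U') :
    q * s.card ≤ Module.finrank F U := by
  have : FiniteDimensional F W := Module.Finite.of_finite
  induction s using Finset.induction_on generalizing U with
  | empty => simp
  | insert j s hj ih =>
    rw [stableUnder_factorOps_iff] at hU
    have hUs : StableUnder (factorOps ρ s) U := stableUnder_factorOps_iff.2 fun i hi =>
      hU i (Finset.mem_insert_of_mem hi)
    rcases s.eq_empty_or_nonempty with rfl | hs
    · obtain ⟨U', hle, hmin⟩ := StableUnder.exists_minimal_le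
        (S := factorOps ρ {j}) (stableUnder_factorOps_iff.2 fun i hi =>
          hU i (by rw [Set.mem_singleton_iff.1 hi]; exact Finset.mem_insert_self j _)) hU0
      have := hq j (Finset.mem_insert_self j _) U' hle hmin
      simpa using this.trans (Submodule.finrank_mono hle)
    · obtain ⟨U', hle, hmin⟩ := hUs.exists_minimal_le hU0
      have hih := ih U' hmin.prop.1 hmin.prop.2
        (fun i hi u hu => hfix i (Finset.mem_insert_of_mem hi) u (hle hu))
        (fun i hi P hP => hq i (Finset.mem_insert_of_mem hi) P (hP.trans hle))
      have hcomm : ∀ t, ∀ a ∈ factorOps ρ s, Commute (ρ (Pi.mulSingle j t)) a := by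
        rintro t _ ⟨i, hi, t', rfl⟩
        have hji : j ≠ i := fun h => hj (h ▸ hi)
        exact (Pi.mulSingle_commute hji t t').map ρ
      obtain ⟨t, ht⟩ : ∃ t, ¬ ∀ u ∈ U', ρ (Pi.mulSingle j t) u ∈ U' := by
        by_contra! hstab
        obtain ⟨u, hu, hu0⟩ := (Submodule.ne_bot_iff _).1 hmin.prop.1
        exact hu0 (hfix j (Finset.mem_insert_self j s) u (hle hu) fun t =>
          hmin.apply_eq_self hT (ρ.comp (MonoidHom.mulSingle (fun _ => T) j)) hcomm hstab t hu)
      -- A translate of `U'` under the new factor meets `U'` trivially.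
      set g : ι → T := Pi.mulSingle j t with hg
      have hginj : Function.Injective (ρ g) := fun x y hxy => by
        have := congrArg (ρ g⁻¹) hxy
        rwa [← Module.End.mul_apply, ← Module.End.mul_apply, ← map_mul, inv_mul_cancel, map_one]
          at this
      have hrank : Module.finrank F (U'.map (ρ g)) = Module.finrank F U' :=
        (Submodule.equivMapOfInjective _ hginj U').finrank_eq.symm
      have hstab : StableUnder (factorOps ρ s) (U'.map (ρ g)) := by
        rintro a ha _ ⟨u, hu, rfl⟩
        refine ⟨a u, hmin.prop.2 a ha u hu, ?_⟩
        exact LinearMap.congr_fun (hcomm t a ha).eq u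
      have hdisj : U' ⊓ U'.map (ρ g) = ⊥ := by
        by_contra hne
        have h1 := hmin.eq_of_le (hmin.prop.2.inf hstab) hne inf_le_left
        have h2 := Submodule.eq_of_le_of_finrank_eq (inf_eq_left.1 h1) hrank.symm
        exact ht fun u hu => h2.ge ⟨u, hu, rfl⟩
      have hsum := Submodule.finrank_sup_add_finrank_inf_eq U' (U'.map (ρ g))
      rw [hdisj, finrank_bot, add_zero, hrank] at hsum
      have hsup : U' ⊔ U'.map (ρ g) ≤ U := by
        refine sup_le hle ?_
        rintro _ ⟨u, hu, rfl⟩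
        exact hU j (Finset.mem_insert_self j s) t u (hle hu)
      have h3 := Submodule.finrank_mono hsup
      rw [Finset.card_insert_of_notMem hj]
      have h4 : 1 ≤ s.card := hs.card_pos
      nlinarith

end FactorOps

section SymplecticModule

variable {ι T W : Type*} [DecidableEq ι] [Group T] [AddCommGroup W]
  [Module (ZMod 2) W] [Finite W]

/-- In a symplectic module for `T ^ ι` over the field of two elements all of whose submodules are
nondegenerate, a minimal nontrivial submodule `U` for the factor `T i` is a faithful irreducible
`T`-module of even dimension. The other factors commute with `T i`, so translating the second
argument of the form by them gives `T i`-invariant forms on `U`, and not all of these vanish. -/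
lemma IsMinimalStable.embedsIrreduciblyGL2 [IsSimpleGroup T]
    (ρ : Representation (ZMod 2) (ι → T) W) (B : LinearMap.BilinForm (ZMod 2) W)
    (hB : ∀ g u v, B (ρ g u) (ρ g v) = B u v)
    (hnd : ∀ P : Submodule (ZMod 2) W, (∀ g, ∀ p ∈ P, ρ g p ∈ P) →
      ∀ x ∈ P, (∀ y ∈ P, B x y = 0) → x = 0)
    (i : ι) (U : Submodule (ZMod 2) W) (hU : IsMinimalStable (factorOps ρ {i}) U)
    (hfix : ∀ u ∈ U, (∀ t, ρ (Pi.mulSingle i t) u = u) → u = 0) :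
    ∃ n, Module.finrank (ZMod 2) U = 2 * n ∧ EmbedsIrreduciblyGL2 T (2 * n) := by
  have : FiniteDimensional (ZMod 2) W := Module.Finite.of_finite
  have : Nontrivial U := Submodule.nontrivial_iff_ne_bot.2 hU.prop.1
  have hUi : ∀ t, ∀ u ∈ U, ρ (Pi.mulSingle i t) u ∈ U :=
    stableUnder_factorOps_iff.1 hU.prop.2 i rfl
  let f : Representation (ZMod 2) T U :=
    { toFun := fun t => (ρ (Pi.mulSingle i t)).restrict (hUi t)
      map_one' := by ext; simp
      map_mul' := fun a b => by ext; simp [Pi.mulSingle_mul] }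
  have hf : ∀ t (u : U), ((f t u : U) : W) = ρ (Pi.mulSingle i t) u := fun _ _ => rfl
  have hirr : ∀ P : Submodule (ZMod 2) U, (∀ t, ∀ p ∈ P, f t p ∈ P) → P = ⊥ ∨ P = ⊤ := by
    intro P hP
    by_cases h0 : P = ⊥
    · exact Or.inl h0
    · right
      have hstab : StableUnder (factorOps ρ {i}) (P.map U.subtype) :=
        stableUnder_factorOps_iff.2 fun j hj t => by
          rw [Set.mem_singleton_iff.1 hj]
          rintro _ ⟨p, hp, rfl⟩
          exact ⟨f t p, hP t p hp, rfl⟩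
      have hinj := Submodule.map_injective_of_injective U.injective_subtype
      have h1 := hU.eq_of_le hstab (fun h => h0 (hinj (h.trans (Submodule.map_bot _).symm)))
        (Submodule.map_subtype_le _ _)
      exact hinj (h1.trans (Submodule.map_subtype_top U).symm)
  have hfix' : ∀ u : U, (∀ t, f t u = u) → u = 0 := fun u hu =>
    Subtype.ext (hfix u u.2 fun t => congrArg Subtype.val (hu t))
  have hfinj : Function.Injective f := by
    rcases f.normal_ker.eq_bot_or_eq_top with h | h
    · exact (f.ker_eq_bot_iff).1 h
    · obtain ⟨u, hu⟩ := exists_ne (0 : U)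
      refine absurd (hfix' u fun t => ?_) hu
      rw [MonoidHom.mem_ker.1 (h ▸ Subgroup.mem_top t)]
      rfl
  obtain ⟨g, hgi, hgB⟩ : ∃ g : ι → T, g i = 1 ∧ ∃ u ∈ U, ∃ v ∈ U, B u (ρ g v) ≠ 0 := by
    by_contra! hzero
    -- The submodule for `T ^ ι` generated by `U`, which would be orthogonal to `U`.
    let P : Submodule (ZMod 2) W := ⨆ g : {g : ι → T // g i = 1}, U.map (ρ g)
    have hP : ∀ g, ∀ p ∈ P, ρ g p ∈ P := by
      intro g
      change P ≤ P.comap (ρ g)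
      refine iSup_le fun c => ?_
      rintro _ ⟨u, hu, rfl⟩
      have h1 : g * (c : ι → T) * Pi.mulSingle i ((g i)⁻¹) * Pi.mulSingle i (g i) = g * (c : ι → T) := by
        rw [mul_assoc, ← Pi.mulSingle_mul, inv_mul_cancel, Pi.mulSingle_one, mul_one]
      refine le_iSup (fun g : {g : ι → T // g i = 1} => U.map (ρ g))
        ⟨g * (c : ι → T) * Pi.mulSingle i ((g i)⁻¹), by simp [c.2]⟩
        ⟨ρ (Pi.mulSingle i (g i)) u, hUi _ u hu, ?_⟩
      rw [← Module.End.mul_apply, ← map_mul, h1, map_mul]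
      rfl
    have hUP : U ≤ P := fun u hu =>
      le_iSup (fun g : {g : ι → T // g i = 1} => U.map (ρ g)) ⟨1, rfl⟩ ⟨u, hu, by simp⟩
    refine hU.prop.1 ((Submodule.eq_bot_iff _).2 fun u hu => hnd P hP u (hUP hu) ?_)
    change P ≤ LinearMap.ker (B u)
    refine iSup_le fun c => ?_
    rintro _ ⟨v, hv, rfl⟩
    exact hzero c c.2 u hu v hv
  have hgcomm : ∀ t, Commute g (Pi.mulSingle i t) := fun t => by
    refine funext fun j => ?_
    by_cases h : j = i
    · subst h; simp [hgi]
    · simp [h]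
  let b : LinearMap.BilinForm (ZMod 2) U := LinearMap.domRestrict₁₂ (B.compl₂ (ρ g)) U U
  have hb : ∀ u v : U, b u v = B u (ρ g v) := fun _ _ => rfl
  obtain ⟨n, hn⟩ := even_finrank_of_invariant_form f hirr hfix' b (fun h => by
    obtain ⟨u, hu, v, hv, huv⟩ := hgB
    exact huv (LinearMap.congr_fun₂ h ⟨u, hu⟩ ⟨v, hv⟩)) (fun t u v => by
    rw [hb, hb, hf, hf, ← Module.End.mul_apply, ← map_mul, (hgcomm t).eq, map_mul,
      Module.End.mul_apply, hB])
  rw [← two_mul] at hn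
  exact ⟨n, hn, hn ▸ embedsIrreduciblyGL2_of_representation f hfinj hirr⟩

/-- The set of the factors of `T ^ ι` that act nontrivially on `P`. -/
def activeFactors (ρ : Representation (ZMod 2) (ι → T) W) (P : Submodule (ZMod 2) W) : Set ι :=
  {i | ∃ t, ∃ p ∈ P, ρ (Pi.mulSingle i t) p ≠ p}

/-- A lower bound for the dimension of a symplectic module for `T ^ ι` over the field of two
elements all of whose submodules are nondegenerate. -/
theorem mul_ncard_activeFactors_le [Fintype ι] [IsSimpleGroup T] (hT : ∃ a b : T, a * b ≠ b * a)
    (ρ : Representation (ZMod 2) (ι → T) W) (B : LinearMap.BilinForm (ZMod 2) W)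
    (halt : LinearMap.IsAlt B) (hB : ∀ g u v, B (ρ g u) (ρ g v) = B u v)
    (hnd : ∀ P : Submodule (ZMod 2) W, (∀ g, ∀ p ∈ P, ρ g p ∈ P) →
      ∀ x ∈ P, (∀ y ∈ P, B x y = 0) → x = 0)
    (q : ℕ) (hq : ∀ n, EmbedsIrreduciblyGL2 T (2 * n) → q ≤ 2 * n)
    (P : Submodule (ZMod 2) W) (hP : ∀ g, ∀ p ∈ P, ρ g p ∈ P) :
    q * (activeFactors ρ P).ncard ≤ Module.finrank (ZMod 2) P := by
  classical
  have : FiniteDimensional (ZMod 2) W := Module.Finite.of_finite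
  generalize hd : Module.finrank (ZMod 2) P = d
  induction d using Nat.strong_induction_on generalizing P with
  | _ d ih =>
    subst hd
    by_cases h0 : P = ⊥
    · have : activeFactors ρ P = ∅ := by
        refine Set.eq_empty_iff_forall_notMem.2 fun i hi => ?_
        obtain ⟨t, p, hp, hne⟩ := hi
        rw [h0, Submodule.mem_bot] at hp
        exact hne (by rw [hp, map_zero])
      simp [this]
    have hstab : ∀ U : Submodule (ZMod 2) W, StableUnder (Set.range ρ) U ↔
        ∀ g, ∀ u ∈ U, ρ g u ∈ U := fun U =>
      ⟨fun h g => h _ ⟨g, rfl⟩, by rintro h _ ⟨g, rfl⟩; exact h g⟩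
    obtain ⟨U, hUP, hU⟩ := ((hstab P).2 hP).exists_minimal_le h0
    have hUg := (hstab U).1 hU.prop.2
    have hdisj : Disjoint U (B.orthogonal U) := by
      rw [Submodule.disjoint_def]
      intro x hx hx'
      refine hnd U hUg x hx fun y hy => ?_
      exact halt.isRefl _ _ (hx' y hy)
    have hcompl := (LinearMap.BilinForm.isCompl_orthogonal_iff_disjoint halt.isRefl).2 hdisj
    set Q := P ⊓ B.orthogonal U with hQdef
    have hQ : ∀ g, ∀ p ∈ Q, ρ g p ∈ Q := by
      intro g p hp
      refine ⟨hP g p hp.1, fun u hu => ?_⟩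
      have h1 : B (ρ g⁻¹ u) p = 0 := hp.2 _ (hUg g⁻¹ u hu)
      rw [← hB g, ← Module.End.mul_apply, ← map_mul, mul_inv_cancel, map_one] at h1
      exact h1
    have hsup : U ⊔ Q = P := by
      rw [hQdef, inf_comm, ← sup_inf_assoc_of_le _ hUP, hcompl.sup_eq_top, top_inf_eq]
    have hinf : U ⊓ Q = ⊥ := (hdisj.mono_right inf_le_right).eq_bot
    have hrank := Submodule.finrank_sup_add_finrank_inf_eq U Q
    rw [hsup, hinf, finrank_bot, add_zero] at hrank
    have hUpos : 0 < Module.finrank (ZMod 2) U := by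
      rw [Nat.pos_iff_ne_zero]
      exact fun h => hU.prop.1 (Submodule.finrank_eq_zero.1 h)
    have hihQ := ih _ (by omega) Q hQ rfl
    have hactive : activeFactors ρ P ⊆ activeFactors ρ U ∪ activeFactors ρ Q := by
      rintro i ⟨t, p, hp, hne⟩
      by_contra hcon
      rw [Set.mem_union, not_or] at hcon
      rw [← hsup] at hp
      obtain ⟨u, hu, v, hv, rfl⟩ := Submodule.mem_sup.1 hp
      refine hne ?_
      have h1 : ρ (Pi.mulSingle i t) u = u := by
        by_contra h; exact hcon.1 ⟨t, u, hu, h⟩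
      have h2 : ρ (Pi.mulSingle i t) v = v := by
        by_contra h; exact hcon.2 ⟨t, v, hv, h⟩
      rw [map_add, h1, h2]
    have hihU : q * (activeFactors ρ U).ncard ≤ Module.finrank (ZMod 2) U := by
      rw [Set.ncard_eq_toFinset_card' (activeFactors ρ U)]
      have hfixU : ∀ i ∈ activeFactors ρ U, ∀ u ∈ U,
          (∀ t, ρ (Pi.mulSingle i t) u = u) → u = 0 := by
        rintro i ⟨t, p, hp, hne⟩ u hu hfix
        let Z : Submodule (ZMod 2) W :=
          U ⊓ ⨅ t, LinearMap.ker (ρ (Pi.mulSingle i t) - LinearMap.id)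
        have hZ : ∀ w, w ∈ Z ↔ w ∈ U ∧ ∀ t, ρ (Pi.mulSingle i t) w = w := fun w => by
          simp [Z, sub_eq_zero]
        by_contra hu0
        have hZU : Z = U := by
          refine hU.eq_of_le ((hstab Z).2 fun g w hw => ?_)
            ((Submodule.ne_bot_iff _).2 ⟨u, (hZ u).2 ⟨hu, hfix⟩, hu0⟩) inf_le_left
          obtain ⟨hw1, hw2⟩ := (hZ w).1 hw
          refine (hZ _).2 ⟨hUg g w hw1, fun t => ?_⟩
          have h1 : Pi.mulSingle i t * g = g * Pi.mulSingle i ((g i)⁻¹ * t * g i) := by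
            refine funext fun j => ?_
            by_cases h : j = i
            · subst h; simp [mul_assoc]
            · simp [h]
          rw [← Module.End.mul_apply, ← map_mul, h1, map_mul, Module.End.mul_apply, hw2]
        exact hne (((hZ p).1 (hZU ▸ hp)).2 t)
      refine mul_card_le_finrank hT ρ q _ U hU.prop.1
        (stableUnder_factorOps_iff.2 fun i _ t => hUg _) (fun i hi => hfixU i (by simpa using hi))
        fun i hi U' hle hmin => ?_
      obtain ⟨n, hn, hemb⟩ := hmin.embedsIrreduciblyGL2 ρ B hB hnd i U' fun u hu =>
        hfixU i (by simpa using hi) u (hle hu)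
      rw [hn]
      exact hq n hemb
    calc q * (activeFactors ρ P).ncard
        ≤ q * ((activeFactors ρ U).ncard + (activeFactors ρ Q).ncard) :=
          Nat.mul_le_mul_left _ ((Set.ncard_le_ncard hactive).trans (Set.ncard_union_le _ _))
      _ ≤ Module.finrank (ZMod 2) P := by rw [mul_add]; omega

end SymplecticModule

/-! ### The kernel of a minimal extension -/

open scoped commutatorElement in
/-- A nontrivial normal subgroup of a nilpotent group meets the center nontrivially. -/
lemma Group.IsNilpotent.inf_center_ne_bot {G : Type*} [Group G] [Group.IsNilpotent G]
    {A : Subgroup G} [hn : A.Normal] (hA : A ≠ ⊥) : A ⊓ Subgroup.center G ≠ ⊥ := by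
  classical
  obtain ⟨n, hn'⟩ := Group.IsNilpotent.nilpotent G
  have hex : ∃ n, A ⊓ Subgroup.upperCentralSeries G n ≠ ⊥ := ⟨n, by rwa [hn', inf_top_eq]⟩
  obtain ⟨x, hx1⟩ := Subgroup.ne_bot_iff_exists_ne_one.1 (Nat.find_spec hex)
  obtain ⟨m, hm⟩ : ∃ m, Nat.find hex = m + 1 := by
    refine Nat.exists_eq_succ_of_ne_zero fun h0 => Nat.find_spec hex ?_
    rw [h0, Subgroup.upperCentralSeries_zero, inf_bot_eq]
  have hbot := not_not.1 (Nat.find_min hex (show m < Nat.find hex by omega))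
  have hxm : (x : G) ∈ Subgroup.upperCentralSeries G (m + 1) := by
    rw [← hm]
    exact x.2.2
  refine Subgroup.ne_bot_iff_exists_ne_one.2
    ⟨⟨x, x.2.1, Subgroup.mem_center_iff.2 fun g => ?_⟩, fun h => hx1 (Subtype.ext ?_)⟩
  · have h1 : ⁅(x : G), g⁆ ∈ A ⊓ Subgroup.upperCentralSeries G m := by
      refine ⟨?_, Subgroup.mem_upperCentralSeries_succ_iff.1 hxm g⟩
      rw [commutatorElement_def, mul_assoc, mul_assoc, ← mul_assoc g]
      exact mul_mem x.2.1 (hn.conj_mem _ (inv_mem x.2.1) g)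
    rw [hbot, Subgroup.mem_bot] at h1
    exact (commutatorElement_eq_one_iff_mul_comm.1 h1).symm
  · exact congrArg (fun z : (A ⊓ Subgroup.center G : Subgroup G) => (z : G)) h

namespace IsMinimalExtension

variable {H G : Type*} [Group H] [Group G] {γ : H →* G}

lemma eq_top_of_sup_eq_top (hγ : IsMinimalExtension γ) {K A : Subgroup H} (hA : A ≤ γ.ker)
    (h : K ⊔ A = ⊤) : K = ⊤ := by
  by_contra hK
  have h1 := hγ.map_lt_top K (lt_top_iff_ne_top.2 hK)
  refine h1.ne ?_
  have h2 : (K ⊔ A).map γ = K.map γ := by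
    rw [Subgroup.map_sup, (Subgroup.map_eq_bot_iff A).2 hA, sup_bot_eq]
  rw [← h2, h, Subgroup.map_top_of_surjective γ hγ.surjective]

lemma ker_le_frattini (hγ : IsMinimalExtension γ) : γ.ker ≤ frattini H := by
  refine le_iInf₂ fun K hK => ?_
  by_contra hle
  exact hK.1 (hγ.eq_top_of_sup_eq_top le_rfl
    (hK.2 _ (lt_of_le_of_ne le_sup_left fun h => hle (h ▸ le_sup_right))))

lemma isNilpotent_ker [Finite H] (hγ : IsMinimalExtension γ) : Group.IsNilpotent γ.ker := by
  have := frattini_nilpotent (G := H)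
  exact Group.nilpotent_of_mulEquiv (Subgroup.subgroupOfEquivOfLe hγ.ker_le_frattini)

lemma inf_centralizer_ne_bot [Finite H] (hγ : IsMinimalExtension γ) {A : Subgroup H} [A.Normal]
    (hA : A ≤ γ.ker) (h0 : A ≠ ⊥) : A ⊓ Subgroup.centralizer γ.ker ≠ ⊥ := by
  have := hγ.isNilpotent_ker
  have h1 : A.subgroupOf γ.ker ≠ ⊥ := by
    rw [Ne, Subgroup.subgroupOf_eq_bot, disjoint_iff, inf_eq_left.2 hA]
    exact h0
  have h2 := Group.IsNilpotent.inf_center_ne_bot h1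
  intro h3
  refine h2 ((Subgroup.eq_bot_iff_forall _).2 fun x hx => Subtype.ext ?_)
  have : (x : H) ∈ A ⊓ Subgroup.centralizer γ.ker :=
    ⟨Subgroup.mem_subgroupOf.1 hx.1, Subgroup.mem_centralizer_iff.2 fun y hy =>
      congrArg Subtype.val (Subgroup.mem_center_iff.1 hx.2 ⟨y, hy⟩)⟩
  rwa [h3, Subgroup.mem_bot] at this

end IsMinimalExtension

namespace TwistedRep

variable {k H V : Type*} [Field k] [Group H] [AddCommGroup V] [Module k V]
variable {R : TwistedRep k H V}

/-- The elements whose operators commute with those of `N`. -/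
def opCentralizer (R : TwistedRep k H V) (N : Subgroup H) : Subgroup H where
  carrier := {d | ∀ x ∈ N, Commute (R.op d) (R.op x)}
  one_mem' := fun x _ => by rw [R.op_one]; exact Commute.one_left _
  mul_mem' := fun {d e} hd he x hx => by
    have h1 : Commute (R.op d * R.op e) (R.op x) := (hd x hx).mul_left (he x hx)
    rw [R.op_mul] at h1
    have h2 := h1.smul_left ((R.cocycle d e)⁻¹ : kˣ)
    rwa [Units.smul_def, smul_smul, Units.inv_mul, one_smul] at h2
  inv_mem' := fun {d} hd x hx => by
    apply (R.isUnit_op d).mul_right_injective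
    dsimp only
    rw [← mul_assoc, R.op_mul_inv, ← mul_assoc, (hd x hx).eq, mul_assoc, R.op_mul_inv,
      smul_mul_assoc, one_mul, mul_smul_comm, mul_one]

instance (N : Subgroup H) [hn : N.Normal] : (R.opCentralizer N).Normal := ⟨fun d hd h x hx => by
  have hx' : h⁻¹ * x * h ∈ N := by simpa using hn.conj_mem x hx h⁻¹
  obtain ⟨a, ha⟩ := R.exists_op_mul_eq_conj h d
  obtain ⟨b, hb⟩ := R.exists_op_mul_eq_conj h (h⁻¹ * x * h)
  rw [show h * (h⁻¹ * x * h) * h⁻¹ = x by group] at hb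
  have h1 : R.op h * (R.op d * R.op (h⁻¹ * x * h)) =
      ((a : k) * b) • (R.op (h * d * h⁻¹) * R.op x * R.op h) := by
    rw [← mul_assoc, ha, smul_mul_assoc, mul_assoc, hb, mul_smul_comm, smul_smul,
      mul_assoc (R.op _)]
  have h2 : R.op h * (R.op (h⁻¹ * x * h) * R.op d) =
      ((a : k) * b) • (R.op x * R.op (h * d * h⁻¹) * R.op h) := by
    rw [← mul_assoc, hb, smul_mul_assoc, mul_assoc, ha, mul_smul_comm, smul_smul,
      mul_assoc (R.op _), mul_comm (b : k)]
  rw [(hd _ hx').eq, h2] at h1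
  have h3 := smul_right_injective _ (mul_ne_zero a.ne_zero b.ne_zero) h1
  exact ((R.isUnit_op h).mul_left_injective h3).symm⟩

lemma Faithful.commute [Nontrivial V] (hf : R.Faithful) {x y : H}
    (h : Commute (R.op x) (R.op y)) : Commute x y := by
  have h1 := h.eq
  rw [R.op_mul, R.op_mul] at h1
  have h2 : R.op (x * y) = ((R.cocycle x y : k)⁻¹ * R.cocycle y x) • R.op (y * x) := by
    rw [mul_smul, ← h1, smul_smul, inv_mul_cancel₀ (Units.ne_zero _), one_smul]
  have h3 := R.op_mul (x * y) (y * x)⁻¹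
  rw [h2, smul_mul_assoc, R.op_mul_inv, smul_smul] at h3
  refine mul_inv_eq_one.1 (hf _ ((R.cocycle (x * y) (y * x)⁻¹ : k)⁻¹ *
    ((R.cocycle x y : k)⁻¹ * R.cocycle y x * R.cocycle (y * x) (y * x)⁻¹)) ?_)
  rw [mul_smul, h3, smul_smul, inv_mul_cancel₀ (Units.ne_zero _), one_smul]

section Structure

variable [IsAlgClosed k] [FiniteDimensional k V] [Finite H] {G : Type*} [Group G] {γ : H →* G}

/-- Every nontrivial normal subgroup of `H` inside the kernel of a minimal extension contains a
central involution of the kernel. The elements of odd order in the center of the kernel form a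
nondegenerate normal subgroup, which has a complement and hence is trivial by minimality. -/
lemma Primitive.exists_involution (hp : R.Primitive) (hi : R.Irreducible) (hf : R.Faithful)
    (hγ : IsMinimalExtension γ) {A : Subgroup H} [A.Normal] (hA : A ≤ γ.ker) (h0 : A ≠ ⊥) :
    ∃ x ∈ A, x ≠ 1 ∧ x ^ 2 = 1 ∧ x ∈ Subgroup.centralizer γ.ker := by
  have := hi.1
  have hZ : ∀ x ∈ γ.ker ⊓ Subgroup.centralizer γ.ker, ∀ y ∈ γ.ker ⊓ Subgroup.centralizer γ.ker,
      Commute x y := fun x hx y hy => Subgroup.mem_centralizer_iff.1 hy.2 x hx.1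
  -- The elements of odd order in the center of the kernel.
  let O : Subgroup H :=
    { carrier := {x | x ∈ γ.ker ⊓ Subgroup.centralizer γ.ker ∧ Odd (orderOf x)}
      one_mem' := ⟨one_mem _, by simp⟩
      mul_mem' := fun {x y} hx hy => ⟨mul_mem hx.1 hy.1,
        (hx.2.mul hy.2).of_dvd_nat (hZ x hx.1 y hy.1).orderOf_mul_dvd_mul_orderOf⟩
      inv_mem' := fun {x} hx => ⟨inv_mem hx.1, by rw [orderOf_inv]; exact hx.2⟩ }
  have hOn : O.Normal := ⟨fun x hx h => ⟨Subgroup.Normal.conj_mem inferInstance x hx.1 h, by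
    have : orderOf (MulAut.conj h x) = orderOf x := orderOf_injective (MulAut.conj h).toMonoidHom
      (MulAut.conj h).injective x
    rw [MulAut.conj_apply] at this
    rw [this]; exact hx.2⟩⟩
  have hOcomm : ∀ a ∈ O, ∀ b ∈ O, Commute a b := fun a ha b hb => hZ a ha.1 b hb.1
  have hOcard : Odd (Nat.card O) := by
    by_contra h
    rw [Nat.not_odd_iff_even, even_iff_two_dvd] at h
    have : Fact (Nat.Prime 2) := ⟨Nat.prime_two⟩
    obtain ⟨x, hx⟩ := exists_prime_orderOf_dvd_card' 2 h
    have h1 := x.2.2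
    rw [Subgroup.orderOf_coe, hx] at h1
    exact absurd h1 (by decide)
  obtain ⟨K, hKO, hKO'⟩ := (hp.nondeg hi hf hOcomm).exists_complement R hOcomm hOcard
  have hK := hγ.eq_top_of_sup_eq_top (fun x (hx : x ∈ O) => hx.1.1) hKO
  rw [hK, top_inf_eq] at hKO'
  have h1 := hγ.inf_centralizer_ne_bot hA h0
  obtain ⟨p, hpp, hpd⟩ := Nat.exists_prime_and_dvd
    (n := Nat.card (A ⊓ Subgroup.centralizer γ.ker : Subgroup H))
    (fun h => h1 (Subgroup.card_eq_one.1 h))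
  have : Fact p.Prime := ⟨hpp⟩
  obtain ⟨x, hx⟩ := exists_prime_orderOf_dvd_card' p hpd
  rw [← Subgroup.orderOf_coe] at hx
  have hx1 : (x : H) ≠ 1 := fun h => by
    rw [h, orderOf_one] at hx
    exact hpp.one_lt.ne hx
  rcases hpp.eq_two_or_odd' with rfl | hodd
  · exact ⟨x, x.2.1, hx1, by rw [← hx]; exact pow_orderOf_eq_one _, x.2.2⟩
  · have : (x : H) ∈ O := ⟨⟨hA x.2.1, x.2.2⟩, by rw [hx]; exact hodd⟩
    rw [hKO', Subgroup.mem_bot] at this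
    exact absurd this hx1

/-- The structure of a minimal extension with a faithful primitive projective representation. The
kernel `M` is an elementary abelian 2-group. The subgroup `D` of elements whose operators commute
with those of `M` meets `M` trivially, and the centralizer of `M` is `D * M`. -/
lemma Primitive.ker_structure (hp : R.Primitive) (hi : R.Irreducible) (hf : R.Faithful)
    (hγ : IsMinimalExtension γ) :
    (∀ x ∈ γ.ker, ∀ y ∈ γ.ker, Commute x y) ∧ (∀ x ∈ γ.ker, x ^ 2 = 1) ∧
      R.opCentralizer γ.ker ⊓ γ.ker = ⊥ ∧
      ∀ h ∈ Subgroup.centralizer (γ.ker : Set H), ∃ y ∈ γ.ker, h * y ∈ R.opCentralizer γ.ker := by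
  have := hi.1
  -- The involutions in the center of the kernel, which turn out to be the whole kernel.
  let N : Subgroup H :=
    { carrier := {x | x ∈ γ.ker ⊓ Subgroup.centralizer γ.ker ∧ x ^ 2 = 1}
      one_mem' := ⟨one_mem _, one_pow 2⟩
      mul_mem' := fun {x y} hx hy => ⟨mul_mem hx.1 hy.1, by
        have hxy : Commute x y := Subgroup.mem_centralizer_iff.1 hy.1.2 x hx.1.1
        rw [hxy.mul_pow, hx.2, hy.2, one_mul]⟩
      inv_mem' := fun {x} hx => ⟨inv_mem hx.1, by rw [inv_pow, hx.2, inv_one]⟩ }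
  have hNn : N.Normal := ⟨fun x hx h => ⟨Subgroup.Normal.conj_mem inferInstance x hx.1 h, by
    rw [conj_pow, hx.2, mul_one, mul_inv_cancel]⟩⟩
  have hNcomm : ∀ a ∈ N, ∀ b ∈ N, Commute a b := fun a ha b hb =>
    Subgroup.mem_centralizer_iff.1 hb.1.2 a ha.1.1
  have hnd := hp.nondeg hi hf hNcomm
  have hDN : ∀ x ∈ R.opCentralizer N, x ∈ N → x = 1 := fun x hx hxN =>
    hnd x hxN fun y hy => (R.pairing_eq_one_iff (hNcomm x hxN y hy)).2 (hx y hy)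
  have hDM : R.opCentralizer N ⊓ γ.ker = ⊥ := by
    by_contra hne
    obtain ⟨x, hx, hx1, hx2, hxc⟩ := hp.exists_involution hi hf hγ inf_le_right hne
    exact hx1 (hDN x hx.1 ⟨⟨hx.2, hxc⟩, hx2⟩)
  have hcent : ∀ h ∈ Subgroup.centralizer (N : Set H), ∃ y ∈ N, h * y ∈ R.opCentralizer N := by
    intro h hh
    have hhN : ∀ x ∈ N, Commute h x := fun x hx => (Subgroup.mem_centralizer_iff.1 hh x hx).symm
    obtain ⟨y, hy, hyh⟩ := hnd.exists_pairing_eq R hNcomm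
      (MonoidHom.mk' (fun x : N => R.pairing h x) fun x z =>
        R.pairing_mul_right (hhN x x.2) (hhN z z.2))
    refine ⟨y⁻¹, inv_mem hy, fun x hx => ?_⟩
    have h1 : R.pairing h x = R.pairing y x := hyh ⟨x, hx⟩
    have hyx := hNcomm y hy x hx
    refine (R.pairing_eq_one_iff ((hhN x hx).mul_left hyx.inv_left)).1 ?_
    rw [R.pairing_mul_left (hhN x hx) hyx.inv_left, R.pairing_inv_left hyx, h1, mul_inv_cancel]
  have hker : γ.ker = N := by
    refine le_antisymm (fun x hx => ?_) fun x hx => hx.1.1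
    obtain ⟨y, hy, hxy⟩ := hcent x (Subgroup.mem_centralizer_iff.2 fun z hz =>
      (Subgroup.mem_centralizer_iff.1 hz.1.2 x hx).symm)
    have : x * y ∈ R.opCentralizer N ⊓ γ.ker := ⟨hxy, mul_mem hx hy.1.1⟩
    rw [hDM, Subgroup.mem_bot] at this
    rw [eq_inv_of_mul_eq_one_left this]
    exact inv_mem hy
  refine ⟨fun x hx y hy => ?_, fun x hx => ?_, ?_, ?_⟩
  · rw [hker] at hx hy
    exact hNcomm x hx y hy
  · rw [hker] at hx
    exact hx.2
  · rwa [← hker] at hDM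
  · rwa [← hker] at hcent

end Structure

end TwistedRep

/-! ### The bound for the degree -/

namespace TwistedRep

section Additive

variable {k : Type*} [Field k]

/-- The identification of `{1, -1}` with the additive group of order two, by the value zero at 1. -/
noncomputable def signToZMod (u : kˣ) : ZMod 2 := by classical exact if u = 1 then 0 else 1

lemma signToZMod_eq_zero_iff {u : kˣ} : signToZMod u = 0 ↔ u = 1 := by
  classical
  unfold signToZMod
  split_ifs with h <;> simp [h]

lemma signToZMod_mul {u v : kˣ} (hu : u ^ 2 = 1) (hv : v ^ 2 = 1) :
    signToZMod (u * v) = signToZMod u + signToZMod v := by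
  classical
  by_cases h : u = 1
  · rw [h, one_mul, signToZMod_eq_zero_iff.2 rfl, zero_add]
  by_cases h' : v = 1
  · rw [h', mul_one, signToZMod_eq_zero_iff.2 rfl, add_zero]
  have hneg : ∀ w : kˣ, w ^ 2 = 1 → w ≠ 1 → w = -1 := fun w hw hw1 => by
    have h2 : (w : k) * w = 1 := by rw [← sq, ← Units.val_pow_eq_pow_val, hw, Units.val_one]
    exact Units.ext ((mul_self_eq_one_iff.1 h2).resolve_left fun h => hw1 (Units.ext h))
  rw [hneg u hu h, hneg v hv h', neg_mul_neg, one_mul, signToZMod_eq_zero_iff.2 rfl,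
    CharTwo.add_self_eq_zero]

end Additive

variable {k H V : Type*} [Field k] [Group H] [AddCommGroup V] [Module k V]
variable {R : TwistedRep k H V}

/-- Let `σ i`, for `i` in `s`, be embeddings of a nonabelian simple group `T` in `H` with normal and
pairwise commuting images. Then every nonzero subspace stable under these images has dimension more
than `|s|`. The image of `σ i` acts on no nonzero subspace by scalars: by irreducibility its
operators would then commute on all of `V`. -/
lemma Irreducible.card_add_one_le_finrank [IsAlgClosed k] [FiniteDimensional k V]
    (hi : R.Irreducible) (hf : R.Faithful) {ι T : Type*} [Group T] [IsSimpleGroup T]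
    (hT : ∃ a b : T, a * b ≠ b * a) (s : Finset ι) (σ : ι → T →* H)
    (hinj : ∀ i ∈ s, Function.Injective (σ i))
    (hcomm : ∀ i ∈ s, ∀ j ∈ s, i ≠ j → ∀ a b, Commute (σ i a) (σ j b))
    (hconj : ∀ i ∈ s, ∀ h t, ∃ t', h * σ i t * h⁻¹ = σ i t')
    (W : Submodule k V) (hW : W ≠ ⊥) (hWs : ∀ i ∈ s, ∀ t, ∀ w ∈ W, R.op (σ i t) w ∈ W) :
    s.card + 1 ≤ Module.finrank k W := by
  have := hi.1
  refine _root_.card_add_one_le_finrank s (fun i => Set.range fun t => R.op (σ i t)) ?_ ?_ W hW ?_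
  · -- The pairing of two factors is a homomorphism from a perfect group to an abelian group.
    rintro i his j hjs hij _ ⟨a, rfl⟩ _ ⟨b, rfl⟩
    refine (R.pairing_eq_one_iff (hcomm i his j hjs hij a b)).1 ?_
    exact IsSimpleGroup.map_eq_one_of_commute hT
      (MonoidHom.mk' (fun b => R.pairing (σ i a) (σ j b)) fun b c => by
        rw [map_mul, R.pairing_mul_right (hcomm i his j hjs hij a b) (hcomm i his j hjs hij a c)])
      (fun _ _ => Commute.all _ _) b
  · rintro i his U hU -
    by_contra! hscal
    let Z : Submodule k V := ⨅ (s : T) (t : T),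
      LinearMap.ker (R.op (σ i s) * R.op (σ i t) - R.op (σ i t) * R.op (σ i s))
    have hZ : ∀ v, v ∈ Z ↔ ∀ s t, R.op (σ i s) (R.op (σ i t) v) =
        R.op (σ i t) (R.op (σ i s) v) := fun v => by
      simp [Z, sub_eq_zero]
    have hZtop : Z = ⊤ := by
      refine (hi.2 Z fun h _ v hv => (hZ _).2 fun s t => ?_).resolve_left fun h0 => hU ?_
      · have hex : ∀ t, ∃ t' : T, ∃ a : k, ∀ w, R.op (σ i t) (R.op h w) =
            a • R.op h (R.op (σ i t') w) := by
          intro t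
          obtain ⟨t', ht'⟩ := hconj i his h⁻¹ t
          obtain ⟨a, ha⟩ := R.exists_op_mul_eq_conj h (σ i t')
          rw [← ht', show h * (h⁻¹ * σ i t * h⁻¹⁻¹) * h⁻¹ = σ i t by group, ht'] at ha
          refine ⟨t', (a : k)⁻¹, fun w => ?_⟩
          rw [← Module.End.mul_apply (R.op h), ha, LinearMap.smul_apply, smul_smul,
            inv_mul_cancel₀ (Units.ne_zero _), one_smul, Module.End.mul_apply]
        obtain ⟨s', a, ha⟩ := hex s
        obtain ⟨t', b, hb⟩ := hex t
        rw [ha, hb, map_smul, map_smul, ha, hb, (hZ v).1 hv s' t', smul_comm]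
      · rw [eq_bot_iff, ← h0]
        intro u hu
        refine (hZ u).2 fun s t => ?_
        obtain ⟨c, hc⟩ := hscal _ ⟨s, rfl⟩
        obtain ⟨d, hd⟩ := hscal _ ⟨t, rfl⟩
        have hcu := Module.End.mem_eigenspace_iff.1 (hc hu)
        have hdu := Module.End.mem_eigenspace_iff.1 (hd hu)
        simp only at hcu hdu
        rw [hcu, hdu, map_smul, map_smul, hcu, hdu, smul_comm]
    obtain ⟨a, b, hab⟩ := hT
    refine hab (hinj i his ?_)
    rw [map_mul, map_mul]
    exact (hf.commute (LinearMap.ext fun v =>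
      (hZ v).1 (hZtop ▸ Submodule.mem_top) a b)).eq
  · rintro i his _ ⟨t, rfl⟩
    exact hWs i his t

/-- A minimal extension of `T ^ ι` that is not an isomorphism and has a faithful primitive
projective representation: the characteristic is not two, and the degree is large. -/
theorem Primitive.card_mul_two_pow_le [IsAlgClosed k] [FiniteDimensional k V] [Finite H]
    {ι T : Type*} [Fintype ι] [DecidableEq ι] [Group T] [IsSimpleGroup T]
    (hT : ∃ a b : T, a * b ≠ b * a) {γ : H →* (ι → T)} (hp : R.Primitive) (hi : R.Irreducible)
    (hf : R.Faithful) (hγ : IsMinimalExtension γ) (hker : γ.ker ≠ ⊥) :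
    ringChar k ≠ 2 ∧ Fintype.card ι * 2 ^ nPrime T ≤ Module.finrank k V := by
  classical
  have := hi.1
  obtain ⟨hMcomm, hMsq, hDM, hcent⟩ := hp.ker_structure hi hf hγ
  have hnd := hp.nondeg hi hf hMcomm
  have hpair : ∀ x ∈ γ.ker, ∀ y ∈ γ.ker, R.pairing x y ^ 2 = 1 := fun x hx y hy => by
    rw [sq, ← R.pairing_mul_left (hMcomm x hx y hy) (hMcomm x hx y hy), ← sq, hMsq x hx,
      R.pairing_one_left]
  refine ⟨fun hchar => hker ((Subgroup.eq_bot_iff_forall _).2 fun x hx => hnd x hx fun y hy => ?_),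
    ?_⟩
  · have : CharP k 2 := hchar ▸ ringChar.charP k
    have h1 := congrArg Units.val (hpair x hx y hy)
    refine Units.ext ?_
    rw [Units.val_pow_eq_pow_val, Units.val_one] at h1
    rw [Units.val_one, ← sub_eq_zero, ← sq_eq_zero_iff, CharTwo.sub_eq_add, CharTwo.add_sq, h1,
      one_pow, CharTwo.add_self_eq_zero]
  -- The kernel as a symplectic module for `T ^ ι` over the field of two elements.
  let : CommGroup γ.ker :=
    { (inferInstance : Group γ.ker) with
      mul_comm := fun a b => Subtype.ext (hMcomm a a.2 b b.2) }
  let : Module (ZMod 2) (Additive γ.ker) := AddCommGroup.zmodModule fun x => by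
    apply Additive.toMul.injective
    rw [toMul_nsmul, toMul_zero]
    exact Subtype.ext (hMsq _ x.toMul.2)
  have hconjker : γ.ker ≤ (MulAut.conjNormal : H →* MulAut γ.ker).ker := fun x hx => by
    refine MonoidHom.mem_ker.2 (MulEquiv.ext fun y => Subtype.ext ?_)
    rw [MulAut.conjNormal_apply, (hMcomm x hx y y.2).eq, mul_inv_cancel_right]
    rfl
  let ψ : (ι → T) →* MulAut γ.ker := γ.liftOfSurjective hγ.surjective ⟨_, hconjker⟩
  have hψ : ∀ h (y : γ.ker), ((ψ (γ h) y : γ.ker) : H) = h * y * h⁻¹ := fun h y => by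
    have h1 : ψ (γ h) = MulAut.conjNormal h :=
      γ.liftOfRightInverse_comp_apply _ (Function.rightInverse_surjInv hγ.surjective)
        ⟨_, hconjker⟩ h
    rw [h1, MulAut.conjNormal_apply]
  let ρ : Representation (ZMod 2) (ι → T) (Additive γ.ker) :=
    { toFun := fun g => AddMonoidHom.toZModLinearMap 2 (ψ g).toMonoidHom.toAdditive
      map_one' := by ext x; simp
      map_mul' := fun g g' => by ext x; simp }
  have hρ : ∀ g (x : Additive γ.ker), (ρ g x).toMul = ψ g x.toMul := fun _ _ => rfl
  let B : LinearMap.BilinForm (ZMod 2) (Additive γ.ker) := AddMonoidHom.toZModLinearMap 2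
    (AddMonoidHom.mk' (fun x => AddMonoidHom.toZModLinearMap 2
      (AddMonoidHom.mk' (fun y => signToZMod (R.pairing (x.toMul : H) (y.toMul : H)))
        fun y z => by
          rw [toMul_add, Subgroup.coe_mul, R.pairing_mul_right
            (hMcomm _ x.toMul.2 _ y.toMul.2) (hMcomm _ x.toMul.2 _ z.toMul.2)]
          exact signToZMod_mul (hpair _ x.toMul.2 _ y.toMul.2) (hpair _ x.toMul.2 _ z.toMul.2)))
      fun x y => by
        ext z
        change signToZMod _ = signToZMod _ + signToZMod _
        rw [toMul_add, Subgroup.coe_mul, R.pairing_mul_left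
          (hMcomm _ x.toMul.2 _ z.toMul.2) (hMcomm _ y.toMul.2 _ z.toMul.2)]
        exact signToZMod_mul (hpair _ x.toMul.2 _ z.toMul.2) (hpair _ y.toMul.2 _ z.toMul.2))
  have hBapp : ∀ x y, B x y = signToZMod (R.pairing (x.toMul : H) (y.toMul : H)) := fun _ _ => rfl
  have halt : LinearMap.IsAlt B := fun x => by
    change B x x = 0
    rw [hBapp, R.pairing_self, signToZMod_eq_zero_iff]
  have hB : ∀ g u v, B (ρ g u) (ρ g v) = B u v := fun g u v => by
    obtain ⟨h, rfl⟩ := hγ.surjective g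
    rw [hBapp, hBapp, hρ, hρ, hψ, hψ, R.pairing_conj (hMcomm _ u.toMul.2 _ v.toMul.2)]
  have hndP : ∀ P : Submodule (ZMod 2) (Additive γ.ker), (∀ g, ∀ p ∈ P, ρ g p ∈ P) →
      ∀ x ∈ P, (∀ y ∈ P, B x y = 0) → x = 0 := by
    intro P hP x hx hxy
    let A : Subgroup H := (AddSubgroup.toSubgroup' P.toAddSubgroup).map γ.ker.subtype
    have hAmem : ∀ y : γ.ker, (y : H) ∈ A ↔ Additive.ofMul y ∈ P := fun y => by
      constructor
      · rintro ⟨z, hz, hzy⟩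
        rw [← Subtype.ext hzy]
        exact hz
      · exact fun hy => ⟨y, hy, rfl⟩
    have hAle : A ≤ γ.ker := Subgroup.map_subtype_le _
    have hAn : A.Normal := ⟨fun y hy h => by
      have h1 := hP (γ h) _ ((hAmem ⟨y, hAle hy⟩).1 hy)
      have h2 := (hAmem (ψ (γ h) ⟨y, hAle hy⟩)).2 h1
      rwa [hψ] at h2⟩
    have hAnd := hp.nondeg hi hf (A := A) fun a ha b hb => hMcomm a (hAle ha) b (hAle hb)
    have h1 := hAnd (x.toMul : H) ((hAmem _).2 hx) fun y hy =>
      signToZMod_eq_zero_iff.1 (hxy (Additive.ofMul ⟨y, hAle hy⟩) ((hAmem _).1 hy))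
    exact Additive.toMul.injective (Subtype.ext h1)
  -- The factors that act trivially on the kernel lift to `H`.
  let J := activeFactors ρ ⊤
  have hlift : ∀ i, i ∉ J → ∀ t, ∃ d ∈ R.opCentralizer γ.ker, γ d = Pi.mulSingle i t := by
    intro i hiJ t
    obtain ⟨h, hh⟩ := hγ.surjective (Pi.mulSingle i t)
    obtain ⟨y, hy, hhy⟩ := hcent h (Subgroup.mem_centralizer_iff.2 fun z hz => by
      have h1 : ρ (Pi.mulSingle i t) (Additive.ofMul (⟨z, hz⟩ : γ.ker)) = Additive.ofMul ⟨z, hz⟩ := by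
        by_contra hne
        exact hiJ ⟨t, _, trivial, hne⟩
      have h2 := congrArg (fun x : Additive γ.ker => (x.toMul : H)) h1
      simp only [hρ] at h2
      rw [← hh, hψ] at h2
      exact (mul_inv_eq_iff_eq_mul.1 h2).symm)
    exact ⟨h * y, hhy, by rw [map_mul, MonoidHom.mem_ker.1 hy, mul_one, hh]⟩
  have hDinj : ∀ d ∈ R.opCentralizer γ.ker, ∀ e ∈ R.opCentralizer γ.ker, γ d = γ e → d = e := by
    intro d hd e he hde
    have : d * e⁻¹ ∈ R.opCentralizer γ.ker ⊓ γ.ker :=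
      Subgroup.mem_inf.2 ⟨mul_mem hd (inv_mem he),
        MonoidHom.mem_ker.2 (by rw [map_mul, map_inv, hde, mul_inv_cancel])⟩
    rw [hDM, Subgroup.mem_bot] at this
    exact mul_inv_eq_one.1 this
  have hσ : ∀ i, ∃ σ : T →* H, i ∉ J →
      ∀ t, σ t ∈ R.opCentralizer γ.ker ∧ γ (σ t) = Pi.mulSingle i t := by
    intro i
    by_cases hiJ : i ∈ J
    · exact ⟨1, fun h => absurd hiJ h⟩
    choose σ hσD hσ using hlift i hiJ
    refine ⟨MonoidHom.mk' σ fun a b => ?_, fun _ t => ⟨hσD t, hσ t⟩⟩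
    refine hDinj _ (hσD _) _ (mul_mem (hσD a) (hσD b)) ?_
    rw [map_mul, hσ, hσ, hσ, Pi.mulSingle_mul]
  choose σ hσ using hσ
  let s : Finset ι := Finset.univ.filter (· ∉ J)
  have hs : ∀ i ∈ s, i ∉ J := fun i his => (Finset.mem_filter.1 his).2
  have hbound : ∀ W : Submodule k V, W ≠ ⊥ →
      R.Stable {d | ∀ x ∈ γ.ker, Commute (R.op d) (R.op x)} W →
      s.card + 1 ≤ Module.finrank k W := by
    intro W hW hWst
    refine hi.card_add_one_le_finrank hf hT s σ (fun i his a b hab => ?_)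
      (fun i his j hjs hij a b => ?_) (fun i his h t => ?_) W hW
      fun i his t => hWst _ (hσ i (hs i his) t).1
    · have h1 := congrArg γ hab
      rw [(hσ i (hs i his) a).2, (hσ i (hs i his) b).2] at h1
      exact Pi.mulSingle_injective i h1
    · have ha := hσ i (hs i his) a
      have hb := hσ j (hs j hjs) b
      refine hDinj _ (mul_mem ha.1 hb.1) _ (mul_mem hb.1 ha.1) ?_
      rw [map_mul, map_mul, ha.2, hb.2]
      have hab : Commute (Pi.mulSingle i a : ι → T) (Pi.mulSingle j b) :=
        Pi.mulSingle_commute (f := fun _ : ι => T) hij a b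
      exact hab.eq
    · have ht := hσ i (hs i his) t
      have ht' := hσ i (hs i his) (γ h i * t * (γ h i)⁻¹)
      refine ⟨_, hDinj _ (Subgroup.Normal.conj_mem inferInstance _ ht.1 h) _ ht'.1 ?_⟩
      rw [map_mul, map_mul, map_inv, ht.2, ht'.2]
      refine funext fun j => ?_
      by_cases hji : j = i
      · subst hji; simp
      · simp [hji]
  have hsq := hnd.sq_mul_card_le hMcomm (s.card + 1) hbound
  -- At least one factor acts nontrivially on the kernel.
  have hJ : J.Nonempty := by
    by_contra hJ
    rw [Set.not_nonempty_iff_eq_empty] at hJ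
    have htriv : ∀ g x, ρ g x = x := by
      intro g x
      have hg : g ∈ ρ.ker := Subgroup.pi_mem_of_mulSingle_mem g fun i => by
        refine MonoidHom.mem_ker.2 (LinearMap.ext fun y => ?_)
        by_contra hne
        exact Set.notMem_empty i (hJ ▸ (⟨g i, y, trivial, hne⟩ : i ∈ J))
      rw [MonoidHom.mem_ker.1 hg]
      rfl
    refine hker ((Subgroup.eq_bot_iff_forall _).2 fun x hx => ?_)
    have h1 := hndP (ZMod 2 ∙ (Additive.ofMul (⟨x, hx⟩ : γ.ker))) (fun g p hp => by rwa [htriv])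
      _ (Submodule.mem_span_singleton_self _) fun y hy => by
        obtain ⟨c, rfl⟩ := Submodule.mem_span_singleton.1 hy
        rw [map_smul, halt _, smul_zero]
    exact congrArg (fun x : Additive γ.ker => (x.toMul : H)) h1
  have hdim := fun q hq => mul_ncard_activeFactors_le hT ρ B halt hB hndP q hq ⊤ fun _ _ _ => trivial
  rw [finrank_top] at hdim
  have hJpos : 1 ≤ J.ncard := (Set.ncard_pos).2 hJ
  -- If this set were empty, `nPrime T` would have the default value zero.
  have hne : {n : ℕ | EmbedsIrreduciblyGL2 T (2 * n)}.Nonempty := by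
    by_contra hempty
    have h1 := hdim (Module.finrank (ZMod 2) (Additive γ.ker) + 1) fun n hn =>
      absurd ⟨n, hn⟩ hempty
    have h2 := (Nat.mul_le_mul_left (Module.finrank (ZMod 2) (Additive γ.ker) + 1) hJpos).trans h1
    omega
  have hn1 : 1 ≤ nPrime T := by
    rw [Nat.one_le_iff_ne_zero]
    intro h0
    obtain ⟨f, hfinj, -⟩ : EmbedsIrreduciblyGL2 T (2 * nPrime T) := Nat.sInf_mem hne
    have : IsEmpty (Fin (2 * nPrime T)) := by rw [h0]; exact Fin.isEmpty
    obtain ⟨a, b, hab⟩ := hT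
    exact hab (hfinj (Units.ext (Subsingleton.elim _ _)))
  have hrank := hdim (2 * nPrime T) fun n hn => Nat.mul_le_mul_left 2 (Nat.sInf_le hn)
  have hcard : Nat.card γ.ker = 2 ^ Module.finrank (ZMod 2) (Additive γ.ker) := by
    have h1 := Module.natCard_eq_pow_finrank (K := ZMod 2) (V := Additive γ.ker)
    rwa [Nat.card_zmod] at h1
  have hle : (s.card + 1) * 2 ^ (nPrime T * J.ncard) ≤ Module.finrank k V := by
    refine (Nat.pow_le_pow_iff_left two_ne_zero).1 (le_trans ?_ hsq)
    rw [mul_pow, ← pow_mul, hcard]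
    refine Nat.mul_le_mul_left _ (Nat.pow_le_pow_right two_pos ?_)
    linarith
  have hsum : Fintype.card ι = s.card + J.ncard := by
    rw [Set.ncard_eq_toFinset_card' J, ← Finset.card_univ,
      ← Finset.card_filter_add_card_filter_not (s := Finset.univ) (· ∉ J)]
    congr 2
    ext i
    simp
  refine le_trans ?_ hle
  obtain ⟨j, hj⟩ : ∃ j, J.ncard = j + 1 := ⟨J.ncard - 1, by omega⟩
  have h2j : j + 1 ≤ 2 ^ (nPrime T * j) :=
    (Nat.lt_two_pow_self (n := j)).trans_le (Nat.pow_le_pow_right two_pos (by nlinarith))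
  rw [hsum, hj, mul_add, mul_one, pow_add, ← mul_assoc]
  refine Nat.mul_le_mul_right _ ?_
  nlinarith [Nat.mul_le_mul_left (s.card + 1) h2j]

end TwistedRep

/-! ### From projective representations to operators -/

section ProjectiveLinear

lemma toLin_scalar_apply {k : Type*} [Field k] {m : ℕ} (u : kˣ) (v : Fin m → k) :
    (Matrix.GeneralLinearGroup.toLin (Matrix.GeneralLinearGroup.scalar (Fin m) u)).val v =
      (u : k) • v := by
  change Matrix.toLin' (Matrix.scalar (Fin m) (u : k)) v = _
  simp

variable {H k : Type*} [Group H] [Field k] {m : ℕ}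

/-- Lifts of the values of a projective representation, as operators on `k ^ m`. -/
lemma exists_twistedRep (lam : H →* Matrix.ProjGenLinGroup (Fin m) k) :
    ∃ (R : TwistedRep k H (Fin m → k)) (g : H → Matrix.GeneralLinearGroup (Fin m) k),
      (∀ h, Matrix.ProjGenLinGroup.mk (g h) = lam h) ∧
      ∀ h, R.op h = (Matrix.GeneralLinearGroup.toLin (g h)).val := by
  classical
  have hex : ∀ h, ∃ g, Matrix.ProjGenLinGroup.mk g = lam h ∧ (h = 1 → g = 1) := fun h => by
    by_cases h1 : h = 1
    · exact ⟨1, by rw [h1, map_one, map_one], fun _ => rfl⟩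
    · obtain ⟨g, hg⟩ := Matrix.ProjGenLinGroup.mk_surjective (lam h)
      exact ⟨g, hg, fun h2 => absurd h2 h1⟩
  choose g hg hg1 using hex
  have hmul : ∀ x y, ∃ u : kˣ, g (x * y) * Matrix.GeneralLinearGroup.scalar (Fin m) u = g x * g y :=
    fun x y => Matrix.ProjGenLinGroup.mk_eq_mk_iff.1 (by rw [map_mul, hg, hg, hg, map_mul])
  choose u hu using hmul
  refine ⟨⟨fun h => (Matrix.GeneralLinearGroup.toLin (g h)).val, u, ?_, fun x y => ?_⟩, g, hg,
    fun _ => rfl⟩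
  · rw [hg1 1 rfl, map_one, Units.val_one]
  · rw [← Units.val_mul, ← map_mul, ← hu, map_mul, Units.val_mul]
    refine LinearMap.ext fun v => ?_
    rw [Module.End.mul_apply, toLin_scalar_apply, map_smul, LinearMap.smul_apply]

variable {lam : H →* Matrix.ProjGenLinGroup (Fin m) k} {R : TwistedRep k H (Fin m → k)}
  {g : H → Matrix.GeneralLinearGroup (Fin m) k}

/-- The full preimage of the image of `lam` consists of the scalar multiples of the lifts. -/
lemma exists_natRep_apply_eq (hg : ∀ h, Matrix.ProjGenLinGroup.mk (g h) = lam h)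
    (hR : ∀ h, R.op h = (Matrix.GeneralLinearGroup.toLin (g h)).val) (s : linearPreimage lam) :
    ∃ (h : H) (u : kˣ), ∀ v, natRep (linearPreimage lam) s v = (u : k) • R.op h v := by
  obtain ⟨h, hh⟩ := s.2
  obtain ⟨u, hu⟩ := Matrix.ProjGenLinGroup.mk_eq_mk_iff.1 ((hg h).trans hh)
  refine ⟨h, u, fun v => ?_⟩
  change (Matrix.GeneralLinearGroup.toLin (s : Matrix.GeneralLinearGroup (Fin m) k)).val v = _
  rw [← hu, map_mul, Units.val_mul, Module.End.mul_apply, toLin_scalar_apply, map_smul, hR]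

lemma IsPrimitiveProjRep.irreducible_twistedRep (hlam : IsPrimitiveProjRep lam)
    (hg : ∀ h, Matrix.ProjGenLinGroup.mk (g h) = lam h)
    (hR : ∀ h, R.op h = (Matrix.GeneralLinearGroup.toLin (g h)).val) : R.Irreducible := by
  have hirr := hlam.irreducible
  constructor
  · by_contra hsub
    rw [not_nontrivial_iff_subsingleton] at hsub
    obtain ⟨P, Q, hPQ⟩ := hirr.toNontrivial
    exact hPQ (Subrepresentation.toSubmodule_injective (Subsingleton.elim _ _))
  · intro W hW
    let P : Subrepresentation (natRep (linearPreimage lam)) :=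
      ⟨W, fun s v hv => by
        obtain ⟨h, u, hu⟩ := exists_natRep_apply_eq hg hR s
        rw [hu]
        exact W.smul_mem _ (hW h trivial v hv)⟩
    rcases hirr.eq_bot_or_eq_top P with h | h
    · exact Or.inl (congrArg Subrepresentation.toSubmodule h)
    · exact Or.inr (congrArg Subrepresentation.toSubmodule h)

lemma IsPrimitiveProjRep.primitive_twistedRep (hlam : IsPrimitiveProjRep lam)
    (hg : ∀ h, Matrix.ProjGenLinGroup.mk (g h) = lam h)
    (hR : ∀ h, R.op h = (Matrix.GeneralLinearGroup.toLin (g h)).val) : R.Primitive := by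
  intro r U hU hint hperm
  by_contra hr
  refine hlam.not_imprimitive ⟨r, U, not_le.1 hr, hU, hint, fun s => ?_⟩
  obtain ⟨h, u, hu⟩ := exists_natRep_apply_eq hg hR s
  obtain ⟨σ, hσ⟩ := hperm h
  refine ⟨σ, fun i => ?_⟩
  have h1 : natRep (linearPreimage lam) s = (u : k) • R.op h := LinearMap.ext hu
  rw [h1, Submodule.map_smul _ _ _ u.ne_zero, hσ]

lemma faithful_twistedRep (hlam : Function.Injective lam)
    (hg : ∀ h, Matrix.ProjGenLinGroup.mk (g h) = lam h)
    (hR : ∀ h, R.op h = (Matrix.GeneralLinearGroup.toLin (g h)).val) : R.Faithful := by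
  intro x c hx
  refine hlam ?_
  rw [map_one, ← hg, Matrix.ProjGenLinGroup.mk_eq_one,
    Matrix.GeneralLinearGroup.mem_center_iff_val_mem_range_scalar]
  refine ⟨c, Matrix.toLin'.injective ?_⟩
  have h1 : Matrix.toLin' (g x).val = R.op x := (hR x).symm
  rw [h1, hx]
  refine LinearMap.ext fun v => ?_
  change Matrix.toLin' (Matrix.scalar (Fin m) c) v = c • v
  simp

end ProjectiveLinear

theorem theorem4 {T H k : Type*} [Group T] [Finite T] [IsSimpleGroup T]
    (hT : ∃ a b : T, a * b ≠ b * a) (l : ℕ) (hl : 0 < l)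
    [Group H] [Finite H] (γ : H →* (Fin l → T)) (hγ : IsMinimalExtension γ)
    [Field k] [IsAlgClosed k] (m : ℕ) (lam : H →* Matrix.ProjGenLinGroup (Fin m) k)
    (hfaithful : Function.Injective lam) (hprim : IsPrimitiveProjRep lam)
    (hm : ringChar k ≠ 2 → m < l * 2 ^ nPrime T) :
    Function.Bijective γ := by
  refine ⟨(MonoidHom.ker_eq_bot_iff γ).1 ?_, hγ.surjective⟩
  by_contra hker
  obtain ⟨R, g, hg, hR⟩ := exists_twistedRep lam
  obtain ⟨hchar, hle⟩ := (hprim.primitive_twistedRep hg hR).card_mul_two_pow_le hT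
    (hprim.irreducible_twistedRep hg hR) (faithful_twistedRep hfaithful hg hR) hγ hker
  rw [Fintype.card_fin, Module.finrank_fin_fun] at hle
  exact absurd (hm hchar) (not_lt.2 hle)
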